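/- Conventions. A map between metric spaces is locally Lipschitz if every point of its domain has a neighbourhood on which the map is Lipschitz. Products with $[0,1]$ carry the product metric. Two maps $f,g:X\to Y$ between metric spaces are locally Lipschitz homotopic if there is a locally Lipschitz map $h:X\times[0,1]\to Y$ with $h(\cdot,0)=f$ and $h(\cdot,1)=g$. Let $[X,Y]_{\mathrm{loc}\text{-}\mathrm{Lip}}$ be the set of locally Lipschitz homotopy classes of locally Lipschitz maps $X\to Y$, and $[X,Y]$ the set of homotopy classes of continuous maps $X\to Y$. The natural map $[X,Y]_{\mathrm{loc}\text{-}\mathrm{Lip}}\to[X,Y]$ sends the class of a locally Lipschitz map $f$ to the homotopy class of $f$. A locally finite open covering $\{U_j\}_{j\in J}$ of a metric space $X$ is good if (1) the closure of each $U_j$ is compact, and (2) every non-empty intersection $V=\bigcap_{i=0}^k U_{j_i}$ of finitely many of its elements has a Lipschitz strong deformation retraction to a point, i.e. there are $p\in V$ and a Lipschitz map $F:V\times[0,1]\to V$ with $F(x,0)=x$, $F(x,1)=p$ and $F(p,t)=p$ for all $x\in V$, $t\in[0,1]$. A metric space $Y$ is locally Lipschitz contractible if for every $p\in Y$ and every $\varepsilon>0$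 there are $r\in(0,\varepsilon]$ and a Lipschitz map $\varphi:B(p,r)\times[0,1]\to B(p,\varepsilon)$ with $\varphi(x,0)=x$ and $\varphi(x,1)=p$ for all $x\in B(p,r)$, where $B(p,r)$ denotes the open ball. Corollary. Let $X$ be a $\sigma$-compact metric space admitting a good covering, and let $Y$ be a locally Lipschitz contractible metric space. Then the natural map $[X,Y]_{\mathrm{loc}\text{-}\mathrm{Lip}}\to[X,Y]$ is bijective. In particular, every continuous map $X\to Y$ is homotopic to a locally Lipschitz map. -/

import Mathlib

open Set Topology
open scoped unitInterval

universe u v w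

/-- `A` is a Lipschitz strong deformation retract of the metric space `X`: there is a Lipschitz map
`F : X × [0,1] → X` with `F(x,0) = x`, `F(x,1) ∈ A` and `F(a,t) = a` for `a ∈ A`.
(The product carries the maximum metric, which is bi-Lipschitz equivalent to the Euclidean one.) -/
def IsLipschitzStrongDeformationRetract {X : Type u} [MetricSpace X] (A : Set X) : Prop :=
  ∃ F : X × I → X, (∃ K, LipschitzWith K F) ∧
    (∀ x, F (x, 0) = x) ∧ (∀ x, F (x, 1) ∈ A) ∧ ∀ a ∈ A, ∀ t, F (a, t) = a

/-- A good covering of a metric space: a locally finite open covering by relatively compact sets,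
such that every non-empty intersection `V` of finitely many (at least one) of its elements, with the
induced metric, has a Lipschitz strong deformation retraction to a point of `V`. -/
structure IsGoodCovering {X : Type u} [MetricSpace X] {J : Type w} (U : J → Set X) : Prop where
  isOpen : ∀ j, IsOpen (U j)
  iUnion_eq : ⋃ j, U j = univ
  locallyFinite : LocallyFinite U
  isCompact_closure : ∀ j, IsCompact (closure (U j))
  exists_center : ∀ s : Finset J, s.Nonempty → (⋂ j ∈ s, U j).Nonempty →
    ∃ p : ↥(⋂ j ∈ s, U j), IsLipschitzStrongDeformationRetract ({p} : Set ↥(⋂ j ∈ s, U j))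

/-- A metric space is locally Lipschitz contractible if for every point `p` and every `ε > 0` there
are `r ∈ (0, ε]` and a Lipschitz map `φ : B(p,r) × [0,1] → B(p,ε)` with
`φ(x,0) = x` and `φ(x,1) = p`. -/
def LocallyLipschitzContractible (Y : Type v) [MetricSpace Y] : Prop :=
  ∀ p : Y, ∀ ε > 0, ∃ r > 0, r ≤ ε ∧ ∃ φ : ↥(Metric.ball p r) × I → ↥(Metric.ball p ε),
    (∃ K, LipschitzWith K φ) ∧ (∀ x, (φ (x, 0) : Y) = x) ∧ ∀ x, (φ (x, 1) : Y) = p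

section

variable {X : Type u} {Y : Type v} [MetricSpace X] [MetricSpace Y]

/-- `f` and `g` are locally Lipschitz homotopic: they are joined by a locally Lipschitz map
`X × [0,1] → Y`. -/
def LocLipHomotopic (f g : X → Y) : Prop :=
  ∃ h : X × I → Y, LocallyLipschitz h ∧ (∀ x, h (x, 0) = f x) ∧ ∀ x, h (x, 1) = g x

theorem locLipHomotopic_refl {f : X → Y} (hf : LocallyLipschitz f) : LocLipHomotopic f f :=
  ⟨fun z => f z.1, hf.comp LipschitzWith.prod_fst.locallyLipschitz, fun _ => rfl, fun _ => rfl⟩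

theorem locLipHomotopic_symm {f g : X → Y} (h : LocLipHomotopic f g) : LocLipHomotopic g f := by
  obtain ⟨h, hl, h0, h1⟩ := h
  have hs : LipschitzWith 1 (fun t : I => σ t) := by
    refine LipschitzWith.of_dist_le_mul fun a b => ?_
    simp only [Subtype.dist_eq, unitInterval.coe_symm_eq, Real.dist_eq, NNReal.coe_one, one_mul]
    rw [abs_sub_comm]
    apply le_of_eq
    congr 1
    ring
  have hp : LocallyLipschitz (fun z : X × I => (z.1, σ z.2)) :=
    LipschitzWith.prod_fst.locallyLipschitz.prodMk
      (hs.comp LipschitzWith.prod_snd).locallyLipschitz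
  exact ⟨fun z => h (z.1, σ z.2), hl.comp hp, fun x => by simp [h1], fun x => by simp [h0]⟩

/-- Two locally Lipschitz maps on `X × [0,1]` that agree over `t = 1/2` can be glued there. -/
theorem locallyLipschitz_glue {A B : X × I → Y} (hA : LocallyLipschitz A) (hB : LocallyLipschitz B)
    (c : I) (hAB : ∀ x, A (x, c) = B (x, c)) :
    LocallyLipschitz (fun z : X × I => if z.2 ≤ c then A z else B z) := by
  intro z₀
  obtain ⟨K₁, s₁, hs₁, h₁⟩ := hA z₀
  obtain ⟨K₂, s₂, hs₂, h₂⟩ := hB z₀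
  obtain ⟨r, hr, hrs⟩ := Metric.mem_nhds_iff.1 (Filter.inter_mem hs₁ hs₂)
  have key : ∀ p ∈ Metric.ball z₀ r, ∀ q ∈ Metric.ball z₀ r, p.2 ≤ c → ¬ q.2 ≤ c →
      dist (A p) (B q) ≤ (K₁ + K₂) * dist p q := by
    intro p hp q hq hpc hqc
    have hqc' : c ≤ q.2 := (not_le.1 hqc).le
    have e1 : (p.2 : ℝ) ≤ c := hpc
    have e2 : (c : ℝ) ≤ q.2 := hqc'
    have hm : (p.1, c) ∈ Metric.ball z₀ r := by
      simp only [Metric.mem_ball, Prod.dist_eq, max_lt_iff, Subtype.dist_eq, Real.dist_eq,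
        abs_lt] at hp hq ⊢
      exact ⟨hp.1, by linarith [hp.2.1], by linarith [hq.2.2]⟩
    have d1 : dist p (p.1, c) ≤ dist p q := by
      simp only [Prod.dist_eq, dist_self, Subtype.dist_eq, Real.dist_eq]
      refine max_le (le_max_of_le_right (abs_nonneg _)) (le_max_of_le_right ?_)
      rw [abs_sub_comm, abs_of_nonneg (by linarith), abs_sub_comm, abs_of_nonneg (by linarith)]
      linarith
    have d2 : dist (p.1, c) q ≤ dist p q := by
      simp only [Prod.dist_eq, Subtype.dist_eq, Real.dist_eq]
      refine max_le_max le_rfl ?_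
      rw [abs_sub_comm, abs_of_nonneg (by linarith), abs_sub_comm, abs_of_nonneg (by linarith)]
      linarith
    have l1 := h₁.dist_le_mul p (hrs hp).1 _ (hrs hm).1
    have l2 := h₂.dist_le_mul _ (hrs hm).2 q (hrs hq).2
    rw [← hAB] at l2
    calc dist (A p) (B q) ≤ dist (A p) (A (p.1, c)) + dist (A (p.1, c)) (B q) :=
          dist_triangle _ _ _
      _ ≤ K₁ * dist p q + K₂ * dist p q :=
          add_le_add (l1.trans (mul_le_mul_of_nonneg_left d1 K₁.2))
            (l2.trans (mul_le_mul_of_nonneg_left d2 K₂.2))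
      _ = (K₁ + K₂) * dist p q := by ring
  refine ⟨K₁ + K₂, Metric.ball z₀ r, Metric.ball_mem_nhds _ hr, ?_⟩
  refine LipschitzOnWith.of_dist_le_mul fun p hp q hq => ?_
  have n1 : (0 : ℝ) ≤ K₁ * dist p q := mul_nonneg K₁.2 dist_nonneg
  have n2 : (0 : ℝ) ≤ K₂ * dist p q := mul_nonneg K₂.2 dist_nonneg
  push_cast
  by_cases hpc : p.2 ≤ c <;> by_cases hqc : q.2 ≤ c <;> simp only [hpc, hqc, if_true, if_false]
  · linarith [h₁.dist_le_mul p (hrs hp).1 q (hrs hq).1]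
  · exact key p hp q hq hpc hqc
  · rw [dist_comm, dist_comm p q]
    exact key q hq p hp hqc hpc
  · linarith [h₂.dist_le_mul p (hrs hp).2 q (hrs hq).2]

theorem locLipHomotopic_trans {f g k : X → Y} (h : LocLipHomotopic f g)
    (h' : LocLipHomotopic g k) : LocLipHomotopic f k := by
  obtain ⟨F, hF, F0, F1⟩ := h
  obtain ⟨G, hG, G0, G1⟩ := h'
  have aux : ∀ b : ℝ, LipschitzWith 2
      (fun t : I => Set.projIcc (0 : ℝ) 1 zero_le_one (2 * (t : ℝ) - b)) := by
    intro b
    have : LipschitzWith 2 (fun t : I => 2 * (t : ℝ) - b) := by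
      refine LipschitzWith.of_dist_le_mul fun x y => le_of_eq ?_
      rw [Subtype.dist_eq, Real.dist_eq, Real.dist_eq, NNReal.coe_ofNat,
        show 2 * (x : ℝ) - b - (2 * (y : ℝ) - b) = 2 * ((x : ℝ) - y) by ring, abs_mul, abs_two]
    have h1 := (LipschitzWith.projIcc (zero_le_one (α := ℝ))).comp this
    rw [one_mul] at h1
    exact h1
  have hp : ∀ b : ℝ, LocallyLipschitz
      (fun z : X × I => (z.1, Set.projIcc (0 : ℝ) 1 zero_le_one (2 * (z.2 : ℝ) - b))) := fun b =>
    LipschitzWith.prod_fst.locallyLipschitz.prodMk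
      ((aux b).comp LipschitzWith.prod_snd).locallyLipschitz
  have e0 : Set.projIcc (0 : ℝ) 1 zero_le_one (2 * ((0 : I) : ℝ) - 0) = 0 :=
    Set.projIcc_of_le_left _ (by simp)
  have e1 : Set.projIcc (0 : ℝ) 1 zero_le_one (2 * ((1 : I) : ℝ) - 1) = 1 :=
    Set.projIcc_of_right_le _ (by norm_num)
  let c : I := ⟨1 / 2, by norm_num, by norm_num⟩
  have ec0 : Set.projIcc (0 : ℝ) 1 zero_le_one (2 * (c : ℝ) - 0) = 1 :=
    Set.projIcc_of_right_le _ (by norm_num [c])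
  have ec1 : Set.projIcc (0 : ℝ) 1 zero_le_one (2 * (c : ℝ) - 1) = 0 :=
    Set.projIcc_of_le_left _ (by norm_num [c])
  have h0c : (0 : I) ≤ c := c.2.1
  have h1c : ¬ (1 : I) ≤ c := fun h => by
    have : (1 : ℝ) ≤ 1 / 2 := h
    norm_num at this
  refine ⟨_, locallyLipschitz_glue (hF.comp (hp 0)) (hG.comp (hp 1)) c ?_, ?_, ?_⟩
  · intro x
    simp only [Function.comp_apply, ec0, ec1, F1, G0]
  · intro x
    simp only [Function.comp_apply, if_pos h0c, e0, F0]
  · intro x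
    simp only [Function.comp_apply, if_neg h1c, e1, G1]

theorem LocLipHomotopic.homotopic {f g : C(X, Y)} (h : LocLipHomotopic f g) : f.Homotopic g := by
  obtain ⟨h, hl, h0, h1⟩ := h
  exact ⟨{ toFun := fun z => h (z.2, z.1)
           continuous_toFun := hl.continuous.comp continuous_swap
           map_zero_left := h0
           map_one_left := h1 }⟩

end

/-- Locally Lipschitz homotopy, as an equivalence relation on the locally Lipschitz maps. -/
def locLipHomotopySetoid (X : Type u) (Y : Type v) [MetricSpace X] [MetricSpace Y] :
    Setoid {f : X → Y // LocallyLipschitz f} where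
  r f g := LocLipHomotopic f.1 g.1
  iseqv := ⟨fun f => locLipHomotopic_refl f.2, locLipHomotopic_symm, locLipHomotopic_trans⟩

/-- Homotopy, as an equivalence relation on the continuous maps. -/
def homotopySetoid (X : Type u) (Y : Type v) [MetricSpace X] [MetricSpace Y] : Setoid C(X, Y) :=
  ⟨ContinuousMap.Homotopic, ContinuousMap.Homotopic.equivalence⟩

/-- The set `[X, Y]_loc-Lip` of locally Lipschitz homotopy classes of locally Lipschitz maps. -/
def LocLipHomotopyClasses (X : Type u) (Y : Type v) [MetricSpace X] [MetricSpace Y] :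
    Type (max u v) :=
  Quotient (locLipHomotopySetoid X Y)

/-- The set `[X, Y]` of homotopy classes of continuous maps. -/
def HomotopyClasses (X : Type u) (Y : Type v) [MetricSpace X] [MetricSpace Y] :
    Type (max u v) :=
  Quotient (homotopySetoid X Y)

/-- The natural map `[X, Y]_loc-Lip → [X, Y]`, sending the class of a locally Lipschitz map to its
homotopy class. -/
def naturalMap (X : Type u) (Y : Type v) [MetricSpace X] [MetricSpace Y] :
    LocLipHomotopyClasses X Y → HomotopyClasses X Y :=
  Quotient.map (sa := locLipHomotopySetoid X Y) (sb := homotopySetoid X Y)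
    (fun f => (⟨f.1, f.2.continuous⟩ : C(X, Y)))
    fun _ _ h => LocLipHomotopic.homotopic h

/-!
Let `N` be the nerve of the good covering of `X`, realized in `ℓ^∞`. It is countable and locally
finite, hence finite-dimensional near each of its points, which `X` and `Y` need not be. The proof
moves the problem from `X` to `N` and solves it there.

*From `X` to `N`* (`IsGoodCovering.exists_domination`). Bump functions subordinate to the covering
give a locally Lipschitz map `φ : X → N`. At a point of `N` the simplices `s` whose coordinates
exceed all others form a flag; their weights `simplexWeight s`, which measure the gap between the
coordinates, serve as times for the contractions of the intersections `V s` of the covering.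
Applying these contractions to a point, the one of the largest simplex first (`descend`), is
possible because a smaller simplex has a larger `V s`. Some weight is always equal to `1`, and the
contraction at time `1` forgets the point to which it is applied (`descend_eq_of_eq_one`). So the
result depends only on the weights, and this gives a locally Lipschitz map `ψ : N → X`. Multiplying
the times by `t ∈ [0,1]` joins `ψ ∘ φ` to the identity.

*On `N × [0,1]`* (`exists_locallyLipschitzAt_nerve_prod`). A continuous map `F` to `Y` can be made
locally Lipschitz over the middle of the interval, with no change at the ends and without the loss
of local Lipschitz continuity anywhere. Locally there are finitely many coordinates; cut them into
small cubes. Each cube is mapped by `F` into a small ball that can be contracted in `Y`; compose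
with the contraction, with a time that is `1` on the cube and `0` off a slightly larger one. This
makes the map constant on the cube. The cubes are grouped by the parity of their centres into `2^n`
classes with disjoint enlargements, and the classes are treated one after the other
(`exists_locallyLipschitzAt_of_parity_mem`). Their number does not depend on the size of the cubes,
so the map stays close enough to `F` throughout. A locally finite sequence of such changes covers
`N`, since it is countable.

Both constructions apply at each stage at most one of a family of contractions, for times that
depend on a parameter (`levelMap`), and rest on the estimate `dist_levelMap_le`.

For surjectivity, `F` is `f ∘ ψ`, constant in time, and the change of `F` at time `1/2` is composed
with `φ`. For injectivity, `F` is a given homotopy composed with `ψ`, slowed down near the ends.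
-/

/-! ### Local Lipschitz continuity at a point -/

/-- `f` is Lipschitz on some neighbourhood of `z`. -/
def LocallyLipschitzAt {Z : Type*} {Y : Type*} [MetricSpace Z] [MetricSpace Y] (f : Z → Y) (z : Z) :
    Prop :=
  ∃ K, ∃ t ∈ 𝓝 z, LipschitzOnWith K f t

section LocallyLipschitzAt

variable {Z : Type*} {Y : Type*} [MetricSpace Z] [MetricSpace Y]

theorem LocallyLipschitzAt.congr {f g : Z → Y} {z : Z} (hf : LocallyLipschitzAt f z)
    (h : f =ᶠ[𝓝 z] g) : LocallyLipschitzAt g z := by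
  obtain ⟨K, t, ht, hK⟩ := hf
  refine ⟨K, t ∩ {x | f x = g x}, Filter.inter_mem ht h, fun x hx y hy => ?_⟩
  rw [← hx.2, ← hy.2]
  exact hK hx.1 hy.1

theorem locallyLipschitzAt_const (p : Y) (z : Z) : LocallyLipschitzAt (fun _ : Z => p) z :=
  ⟨0, univ, Filter.univ_mem, (LipschitzWith.const p).lipschitzOnWith⟩

theorem locallyLipschitzAt_of_dist_le {f : Z → Y} {z : Z} {s : Set Z} (hs : s ∈ 𝓝 z) (C : ℝ)
    (h : ∀ x ∈ s, ∀ y ∈ s, dist (f x) (f y) ≤ C * dist x y) : LocallyLipschitzAt f z :=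
  ⟨C.toNNReal, s, hs, LipschitzOnWith.of_dist_le_mul fun x hx y hy => (h x hx y hy).trans
    (mul_le_mul_of_nonneg_right (Real.le_coe_toNNReal C) dist_nonneg)⟩

theorem LocallyLipschitzAt.comp {W : Type*} [MetricSpace W] {f : Z → Y} {g : W → Z} {x : W}
    (hf : LocallyLipschitzAt f (g x)) (hg : LocallyLipschitz g) :
    LocallyLipschitzAt (fun x => f (g x)) x := by
  obtain ⟨K, s, hs, hK⟩ := hf
  obtain ⟨K', s', hs', hK'⟩ := hg x
  exact ⟨K * K', s' ∩ g ⁻¹' s, Filter.inter_mem hs' (hg.continuous.continuousAt.preimage_mem_nhds hs),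
    hK.comp (hK'.mono inter_subset_left) fun y hy => hy.2⟩

end LocallyLipschitzAt

/-! ### Lipschitz contractions and their application one level at a time -/

/-- `Φ` contracts the set `V` inside `W` to the point `p`, with time in `[0,1]` and with the
Lipschitz constant `L`. Only the values on `V × [0,1]` matter; time is a real number, so that no
subtypes are needed. -/
structure IsLipContraction {Y : Type*} [MetricSpace Y] (L : ℝ) (V W : Set Y) (Φ : Y → ℝ → Y)
    (p : Y) : Prop where
  dist_le : ∀ y ∈ V, ∀ y' ∈ V, ∀ t ∈ Icc (0 : ℝ) 1, ∀ t' ∈ Icc (0 : ℝ) 1,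
    dist (Φ y t) (Φ y' t') ≤ L * max (dist y y') |t - t'|
  zero : ∀ y ∈ V, Φ y 0 = y
  one : ∀ y ∈ V, Φ y 1 = p
  mem : ∀ y ∈ V, ∀ t ∈ Icc (0 : ℝ) 1, Φ y t ∈ W

theorem IsLipContraction.mono {Y : Type*} [MetricSpace Y] {L L' : ℝ} {V V' W W' : Set Y}
    {Φ : Y → ℝ → Y} {p : Y} (h : IsLipContraction L V W Φ p) (hL : L ≤ L') (hV : V' ⊆ V)
    (hW : W ⊆ W') : IsLipContraction L' V' W' Φ p where
  dist_le y hy y' hy' t ht t' ht' := (h.dist_le y (hV hy) y' (hV hy') t ht t' ht').trans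
    (mul_le_mul_of_nonneg_right hL (dist_nonneg.trans (le_max_left _ _)))
  zero y hy := h.zero y (hV hy)
  one y hy := h.one y (hV hy)
  mem y hy t ht := hW (h.mem y (hV hy) t ht)

/-- A Lipschitz contraction defined on a product of subtypes, as an `IsLipContraction`. -/
theorem exists_isLipContraction {Y : Type*} [MetricSpace Y] {V W : Set Y} {p : Y}
    (F : V × I → W) {K : NNReal} (hF : LipschitzWith K F) (h0 : ∀ x, (F (x, 0) : Y) = x)
    (h1 : ∀ x, (F (x, 1) : Y) = p) : ∃ Φ, IsLipContraction K V W Φ p := by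
  classical
  refine ⟨fun y t => if h : y ∈ V ∧ t ∈ Icc (0 : ℝ) 1 then F (⟨y, h.1⟩, ⟨t, h.2⟩) else y, ?_, ?_, ?_,
    ?_⟩
  · intro y hy y' hy' t ht t' ht'
    rw [dif_pos ⟨hy, ht⟩, dif_pos ⟨hy', ht'⟩]
    exact hF.dist_le_mul _ _
  · intro y hy
    have h : y ∈ V ∧ (0 : ℝ) ∈ Icc (0 : ℝ) 1 := ⟨hy, by simp⟩
    rw [dif_pos h]
    exact h0 ⟨y, hy⟩
  · intro y hy
    have h : y ∈ V ∧ (1 : ℝ) ∈ Icc (0 : ℝ) 1 := ⟨hy, by simp⟩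
    rw [dif_pos h]
    exact h1 ⟨y, hy⟩
  · intro y hy t ht
    rw [dif_pos ⟨hy, ht⟩]
    exact Subtype.coe_prop _

/-- On a compact set of centres, the contractions of a locally Lipschitz contractible space can be
chosen with a common radius and a common Lipschitz constant (but then they contract to points
other than the centres). -/
theorem LocallyLipschitzContractible.exists_uniform {Y : Type*} [MetricSpace Y]
    (hY : LocallyLipschitzContractible Y) {Q : Set Y} (hQ : IsCompact Q) {ε : ℝ} (hε : 0 < ε) :
    ∃ δ > 0, ∃ L ≥ 0, ∀ q ∈ Q, ∃ Φ p,
      IsLipContraction L (Metric.ball q δ) (Metric.ball q ε) Φ p := by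
  have hloc : ∀ p : Y, ∃ r > 0, r ≤ ε / 2 ∧ ∃ K : NNReal, ∃ Φ,
      IsLipContraction (K : ℝ) (Metric.ball p r) (Metric.ball p (ε / 2)) Φ p := by
    intro p
    obtain ⟨r, hr, hre, φ, ⟨K, hK⟩, h0, h1⟩ := hY p (ε / 2) (half_pos hε)
    exact ⟨r, hr, hre, K, exists_isLipContraction φ hK h0 h1⟩
  choose r hr hre K Φ hΦ using hloc
  obtain ⟨T, hT⟩ := hQ.elim_finite_subcover (fun p => Metric.ball p (r p / 2))
    (fun p => Metric.isOpen_ball)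
    (fun q _ => mem_iUnion.2 ⟨q, Metric.mem_ball_self (half_pos (hr q))⟩)
  obtain ⟨δ, hδ, hδr⟩ : ∃ δ > 0, ∀ p ∈ T, δ ≤ r p / 2 := by
    rcases T.eq_empty_or_nonempty with rfl | hne
    · exact ⟨1, one_pos, by simp⟩
    · obtain ⟨p, -, hp⟩ := T.exists_min_image r hne
      exact ⟨r p / 2, half_pos (hr p), fun q hq => by linarith [hp q hq]⟩
  refine ⟨δ, hδ, ∑ p ∈ T, (K p : ℝ), Finset.sum_nonneg fun p _ => (K p).2, fun q hq => ?_⟩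
  obtain ⟨p, hp, hqp⟩ : ∃ p ∈ T, q ∈ Metric.ball p (r p / 2) := by
    simpa using hT hq
  refine ⟨Φ p, p, (hΦ p).mono ?_ ?_ ?_⟩
  · exact Finset.single_le_sum (f := fun p => (K p : ℝ)) (fun p _ => (K p).2) hp
  · intro y hy
    simp only [Metric.mem_ball] at hy hqp ⊢
    linarith [dist_triangle y q p, hδr p hp]
  · intro y hy
    simp only [Metric.mem_ball] at hy hqp ⊢
    linarith [dist_triangle_right y q p, hre p]

open Classical in
/-- Apply to `y` the map `Φ s` at time `a s`, for the index `s` with `a s > 0`; there should be at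
most one such index. If there is none, `y` is left where it is. -/
noncomputable def levelMap {S Y : Type*} (Φ : S → Y → ℝ → Y) (a : S → ℝ) (y : Y) : Y :=
  if h : ∃ s, 0 < a s then Φ h.choose y (a h.choose) else y

section levelMap

variable {S Y : Type*} {Φ : S → Y → ℝ → Y} {a a' : S → ℝ} {y y' : Y}

theorem levelMap_eq {s : S} (hs : 0 < a s) (hu : ∀ s', 0 < a s' → s' = s) :
    levelMap Φ a y = Φ s y (a s) := by
  have h : ∃ s, 0 < a s := ⟨s, hs⟩
  rw [levelMap, dif_pos h, hu _ h.choose_spec]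

theorem levelMap_of_forall_le (h : ∀ s, a s ≤ 0) : levelMap Φ a y = y := by
  rw [levelMap, dif_neg]
  push Not
  exact h

/-- The weights and the points may change at the same time, and the index in use may change with
them: where the index `s` stops being in use, the weight `a s` is small, so `Φ s` hardly moves its
argument. -/
theorem dist_levelMap_le [MetricSpace Y] {V W : S → Set Y} {p : S → Y} {L ρ : ℝ} (hL : 0 ≤ L)
    (hΦ : ∀ s, 0 < a s ∨ 0 < a' s → IsLipContraction L (V s) (W s) (Φ s) (p s))
    (h0 : ∀ s, 0 ≤ a s) (h1 : ∀ s, a s ≤ 1) (h0' : ∀ s, 0 ≤ a' s) (h1' : ∀ s, a' s ≤ 1)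
    (hu : ∀ s s', 0 < a s → 0 < a s' → s = s') (hu' : ∀ s s', 0 < a' s → 0 < a' s' → s = s')
    (hy : ∀ s, 0 < a s → y ∈ V s) (hy' : ∀ s, 0 < a' s → y' ∈ V s)
    (hρ : dist y y' ≤ ρ) (ha : ∀ s, |a s - a' s| ≤ ρ) :
    dist (levelMap Φ a y) (levelMap Φ a' y') ≤ (2 * L + 1) * ρ := by
  have hρ0 : 0 ≤ ρ := dist_nonneg.trans hρ
  have move : ∀ {b : S → ℝ} {x : Y} (s : S), IsLipContraction L (V s) (W s) (Φ s) (p s) →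
      0 ≤ b s → b s ≤ 1 → x ∈ V s → dist (Φ s x (b s)) x ≤ L * b s := by
    intro b x s h hb hb1 hx
    have := h.dist_le x hx x hx (b s) ⟨hb, hb1⟩ 0 (by simp)
    rw [h.zero x hx, dist_self, sub_zero, abs_of_nonneg hb, max_eq_right hb] at this
    exact this
  have hLρ : 0 ≤ L * ρ := mul_nonneg hL hρ0
  by_cases e : ∃ s, 0 < a s
  · obtain ⟨s, hs⟩ := e
    rw [levelMap_eq hs fun s' hs' => hu _ _ hs' hs]
    have m1 := move s (hΦ s (Or.inl hs)) (h0 s) (h1 s) (hy s hs)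
    by_cases e' : ∃ s', 0 < a' s'
    · obtain ⟨s', hs'⟩ := e'
      rw [levelMap_eq hs' fun s'' hs'' => hu' _ _ hs'' hs']
      by_cases hss : s = s'
      · subst hss
        refine ((hΦ s (Or.inl hs)).dist_le y (hy s hs) y' (hy' s hs') _ ⟨h0 s, h1 s⟩ _
          ⟨h0' s, h1' s⟩).trans ?_
        have := mul_le_mul_of_nonneg_left (max_le hρ (ha s)) hL
        linarith
      · have m2 := move s' (hΦ s' (Or.inr hs')) (h0' s') (h1' s') (hy' s' hs')
        have z1 : a' s = 0 :=
          le_antisymm (not_lt.1 fun h => hss (hu' _ _ h hs')) (h0' s)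
        have z2 : a s' = 0 :=
          le_antisymm (not_lt.1 fun h => hss (hu _ _ hs h)) (h0 s')
        have b1 : a s ≤ ρ := by have := ha s; rw [z1, sub_zero, abs_of_pos hs] at this; exact this
        have b2 : a' s' ≤ ρ := by
          have := ha s'; rw [z2, zero_sub, abs_neg, abs_of_pos hs'] at this; exact this
        have c1 := mul_le_mul_of_nonneg_left b1 hL
        have c2 := mul_le_mul_of_nonneg_left b2 hL
        have t := dist_triangle4 (Φ s y (a s)) y y' (Φ s' y' (a' s'))
        rw [dist_comm y'] at t
        linarith
    · push Not at e'
      rw [levelMap_of_forall_le e']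
      have b1 : a s ≤ ρ := by linarith [le_abs_self (a s - a' s), ha s, e' s]
      have c1 := mul_le_mul_of_nonneg_left b1 hL
      linarith [dist_triangle (Φ s y (a s)) y y']
  · push Not at e
    rw [levelMap_of_forall_le e]
    by_cases e' : ∃ s', 0 < a' s'
    · obtain ⟨s', hs'⟩ := e'
      rw [levelMap_eq hs' fun s'' hs'' => hu' _ _ hs'' hs']
      have m2 := move s' (hΦ s' (Or.inr hs')) (h0' s') (h1' s') (hy' s' hs')
      have b2 : a' s' ≤ ρ := by linarith [neg_abs_le (a s' - a' s'), ha s', e s']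
      have c2 := mul_le_mul_of_nonneg_left b2 hL
      have t := dist_triangle y y' (Φ s' y' (a' s'))
      rw [dist_comm y'] at t
      linarith
    · push Not at e'
      rw [levelMap_of_forall_le e']
      linarith

end levelMap

section levelMapContinuity

variable {Z Y S : Type*} [MetricSpace Z] [MetricSpace Y] {a : S → Z → ℝ} {V W : S → Set Y}
  {Φ : S → Y → ℝ → Y} {p : S → Y} {L M : ℝ} {G : Z → Y}

/-- The estimate `dist_levelMap_le` along a map `G`, with equi-Lipschitz weights. -/
theorem dist_levelMap_comp_le (hL : 0 ≤ L)
    (hΦ : ∀ s z, 0 < a s z → IsLipContraction L (V s) (W s) (Φ s) (p s))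
    (h0 : ∀ s z, 0 ≤ a s z) (h1 : ∀ s z, a s z ≤ 1)
    (hu : ∀ z s s', 0 < a s z → 0 < a s' z → s = s')
    (hM : ∀ s z z', |a s z - a s z'| ≤ M * dist z z')
    (hG : ∀ s z, 0 < a s z → G z ∈ V s) (z z' : Z) :
    dist (levelMap Φ (a · z) (G z)) (levelMap Φ (a · z') (G z')) ≤
      (2 * L + 1) * max (dist (G z) (G z')) (M * dist z z') :=
  dist_levelMap_le (V := V) (W := W) (p := p) hL
    (fun s hs => hs.elim (hΦ s z) (hΦ s z')) (h0 · z) (h1 · z) (h0 · z') (h1 · z') (hu z) (hu z')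
    (hG · z) (hG · z') (le_max_left _ _) fun s => (hM s z z').trans (le_max_right _ _)

theorem continuous_of_dist_le_max {G' : Z → Y} {C : ℝ} (hG : Continuous G)
    (h : ∀ z z', dist (G' z) (G' z') ≤ C * max (dist (G z) (G z')) (M * dist z z')) :
    Continuous G' := by
  rw [continuous_iff_continuousAt]
  intro z
  rw [ContinuousAt, tendsto_iff_dist_tendsto_zero]
  have hlim : Filter.Tendsto (fun x => C * max (dist (G x) (G z)) (M * dist x z)) (𝓝 z) (𝓝 0) := by
    have : Continuous fun x => C * max (dist (G x) (G z)) (M * dist x z) := by fun_prop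
    have := this.tendsto z
    simpa using this
  exact squeeze_zero (fun _ => dist_nonneg) (fun x => h x z) hlim

theorem LocallyLipschitzAt.of_dist_le_max {G' : Z → Y} {C : ℝ} {z : Z}
    (hG : LocallyLipschitzAt G z) (hC : 0 ≤ C)
    (h : ∀ z z', dist (G' z) (G' z') ≤ C * max (dist (G z) (G z')) (M * dist z z')) :
    LocallyLipschitzAt G' z := by
  obtain ⟨K, t, ht, hK⟩ := hG
  refine locallyLipschitzAt_of_dist_le ht (C * max (K : ℝ) M) fun x hx y hy => (h x y).trans ?_
  rw [mul_assoc]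
  refine mul_le_mul_of_nonneg_left (max_le ?_ ?_) hC
  · exact (hK.dist_le_mul x hx y hy).trans
      (mul_le_mul_of_nonneg_right (le_max_left _ _) dist_nonneg)
  · exact mul_le_mul_of_nonneg_right (le_max_right _ _) dist_nonneg

end levelMapContinuity

theorem abs_clamp_sub_clamp_le (x y : ℝ) : |max 0 (min 1 x) - max 0 (min 1 y)| ≤ |x - y| := by
  refine (abs_max_sub_max_le_max _ _ _ _).trans (max_le (by simp) ?_)
  exact (abs_min_sub_min_le_max _ _ _ _).trans (max_le (by simp) le_rfl)

/-! ### Making a map locally Lipschitz on a finite-dimensional piece -/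

/-- A bump function on `ℝ^ι`: it is `1` on the cube of radius `5/8` and `0` off the cube of radius
`3/4`. Its translates by the integer points of one parity class have disjoint supports, while the
cubes of radius `1/2 < 5/8` around all integer points cover `ℝ^ι`. -/
noncomputable def cubeBump {ι : Type*} [Fintype ι] (v : ι → ℝ) : ℝ := max 0 (min 1 (6 - 8 * ‖v‖))

section cubeBump

variable {ι : Type*} [Fintype ι]

theorem cubeBump_nonneg (v : ι → ℝ) : 0 ≤ cubeBump v := le_max_left _ _

theorem cubeBump_le_one (v : ι → ℝ) : cubeBump v ≤ 1 := max_le zero_le_one (min_le_left _ _)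

theorem norm_lt_of_cubeBump_pos {v : ι → ℝ} (h : 0 < cubeBump v) : ‖v‖ < 3 / 4 := by
  by_contra! h'
  refine h.ne' (max_eq_left ((min_le_right _ _).trans ?_))
  linarith

theorem cubeBump_eq_one {v : ι → ℝ} (h : ‖v‖ ≤ 5 / 8) : cubeBump v = 1 := by
  rw [cubeBump, min_eq_left (by linarith), max_eq_right zero_le_one]

theorem abs_cubeBump_sub_le (v v' : ι → ℝ) : |cubeBump v - cubeBump v'| ≤ 8 * ‖v - v'‖ := by
  have h1 : |(6 - 8 * ‖v‖) - (6 - 8 * ‖v'‖)| ≤ 8 * ‖v - v'‖ := by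
    have := abs_norm_sub_norm_le v v'
    rw [show (6 - 8 * ‖v‖) - (6 - 8 * ‖v'‖) = -8 * (‖v‖ - ‖v'‖) by ring, abs_mul]
    norm_num
    linarith
  exact (abs_clamp_sub_clamp_le _ _).trans h1

/-- Distinct integer points of the same parity class are at distance at least `2`. -/
theorem eq_of_norm_sub_lt {v : ι → ℝ} {c c' : ι → ℤ}
    (hcc : ∀ i, (c i : ZMod 2) = (c' i : ZMod 2)) (h : ‖v - fun i => (c i : ℝ)‖ < 3 / 4)
    (h' : ‖v - fun i => (c' i : ℝ)‖ < 3 / 4) : c = c' := by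
  funext i
  obtain ⟨k, hk⟩ := (ZMod.intCast_eq_intCast_iff_dvd_sub _ _ 2).1 (hcc i)
  have e := (norm_le_pi_norm _ i).trans_lt h
  have e' := (norm_le_pi_norm _ i).trans_lt h'
  simp only [Pi.sub_apply, Real.norm_eq_abs, abs_lt] at e e'
  have hk' : (c' i : ℝ) - c i = 2 * k := by exact_mod_cast hk
  have k1 : (k : ℝ) < 1 := by linarith [e.1, e.2, e'.1, e'.2]
  have k2 : (-1 : ℝ) < k := by linarith [e.1, e.2, e'.1, e'.2]
  have k1' : k < 1 := by exact_mod_cast k1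
  have k2' : -1 < k := by exact_mod_cast k2
  have : k = 0 := by omega
  subst this
  omega

end cubeBump

theorem abs_mul_sub_mul_le {x x' b b' : ℝ} (hx : |x'| ≤ 1) (hb : |b| ≤ 1) :
    |x * b - x' * b'| ≤ |x - x'| + |b - b'| := by
  calc |x * b - x' * b'| = |(x - x') * b + x' * (b - b')| := by congr 1; ring
    _ ≤ |(x - x') * b| + |x' * (b - b')| := abs_add_le _ _
    _ ≤ |x - x'| + |b - b'| := by
      rw [abs_mul, abs_mul]
      exact add_le_add (mul_le_of_le_one_right (abs_nonneg _) hb)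
        (mul_le_of_le_one_left (abs_nonneg _) hx)

section gridWeight

variable {Z ι : Type*} [Fintype ι]

open Classical in
/-- The weights used for the parity class `κ`: the integer point `c` of that class has as its
weight the cut-off `w` times the bump function around `h • c` at scale `h` in the
coordinates `θ`. -/
noncomputable def gridWeight (w : Z → ℝ) (θ : Z → ι → ℝ) (h : ℝ) (κ : ι → ZMod 2) (c : ι → ℤ)
    (z : Z) : ℝ :=
  if (fun i => (c i : ZMod 2)) = κ then w z * cubeBump (h⁻¹ • θ z - fun i => (c i : ℝ)) else 0

variable {w : Z → ℝ} {θ : Z → ι → ℝ} {h : ℝ} {κ : ι → ZMod 2} {c c' : ι → ℤ} {z z' : Z}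

theorem gridWeight_nonneg (hw : ∀ z, 0 ≤ w z) : 0 ≤ gridWeight w θ h κ c z := by
  unfold gridWeight
  split_ifs
  exacts [mul_nonneg (hw z) (cubeBump_nonneg _), le_rfl]

theorem gridWeight_le_one (hw : ∀ z, w z ≤ 1) : gridWeight w θ h κ c z ≤ 1 := by
  unfold gridWeight
  split_ifs
  exacts [mul_le_one₀ (hw z) (cubeBump_nonneg _) (cubeBump_le_one _), zero_le_one]

theorem of_gridWeight_pos (hw : ∀ z, 0 ≤ w z) (hp : 0 < gridWeight w θ h κ c z) :
    (fun i => (c i : ZMod 2)) = κ ∧ 0 < w z ∧ ‖h⁻¹ • θ z - fun i => (c i : ℝ)‖ < 3 / 4 := by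
  unfold gridWeight at hp
  split_ifs at hp with hc
  · have h1 : 0 < w z := (hw z).lt_of_ne' (left_ne_zero_of_mul hp.ne')
    exact ⟨hc, h1, norm_lt_of_cubeBump_pos (pos_of_mul_pos_right hp h1.le)⟩
  · exact absurd hp (lt_irrefl _)

theorem eq_of_gridWeight_pos (hw : ∀ z, 0 ≤ w z) (hp : 0 < gridWeight w θ h κ c z)
    (hp' : 0 < gridWeight w θ h κ c' z) : c = c' := by
  obtain ⟨e, -, l⟩ := of_gridWeight_pos hw hp
  obtain ⟨e', -, l'⟩ := of_gridWeight_pos hw hp'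
  exact eq_of_norm_sub_lt (congrFun (e.trans e'.symm)) l l'

theorem dist_lt_of_gridWeight_pos (hw : ∀ z, 0 ≤ w z) (hh : 0 < h)
    (hp : 0 < gridWeight w θ h κ c z) (hp' : 0 < gridWeight w θ h κ c z') :
    dist (θ z) (θ z') < 2 * h := by
  obtain ⟨-, -, l⟩ := of_gridWeight_pos hw hp
  obtain ⟨-, -, l'⟩ := of_gridWeight_pos hw hp'
  have : ‖h⁻¹ • (θ z - θ z')‖ < 2 := by
    rw [smul_sub, ← sub_sub_sub_cancel_right _ _ (fun i => (c i : ℝ))]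
    exact (norm_sub_le _ _).trans_lt (by linarith)
  rw [norm_smul, Real.norm_of_nonneg (inv_nonneg.2 hh.le), ← dist_eq_norm, inv_mul_lt_iff₀ hh] at this
  linarith

theorem abs_gridWeight_sub_le [MetricSpace Z] {A B : NNReal} (hw : ∀ z, 0 ≤ w z) (hw1 : ∀ z, w z ≤ 1)
    (hwl : LipschitzWith A w) (hθ : LipschitzWith B θ) (hh : 0 < h) :
    |gridWeight w θ h κ c z - gridWeight w θ h κ c z'| ≤ (A + 8 * (h⁻¹ * B)) * dist z z' := by
  unfold gridWeight
  split_ifs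
  · refine (abs_mul_sub_mul_le (abs_le.2 ⟨by linarith [hw z'], hw1 z'⟩)
      (abs_le.2 ⟨by linarith [cubeBump_nonneg (h⁻¹ • θ z - fun i => (c i : ℝ))],
        cubeBump_le_one _⟩)).trans ?_
    rw [add_mul]
    refine add_le_add (hwl.dist_le_mul z z') ((abs_cubeBump_sub_le _ _).trans ?_)
    rw [sub_sub_sub_cancel_right, ← smul_sub, norm_smul, Real.norm_of_nonneg (inv_nonneg.2 hh.le),
      ← dist_eq_norm, mul_assoc, mul_assoc]
    refine mul_le_mul_of_nonneg_left (mul_le_mul_of_nonneg_left (hθ.dist_le_mul z z')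
      (inv_nonneg.2 hh.le)) (by norm_num)
  · simp only [sub_self, abs_zero]
    positivity

theorem eventually_gridWeight_eq_one [MetricSpace Z] (hθ : Continuous θ) (hw : ∀ᶠ x in 𝓝 z, w x = 1) :
    ∀ᶠ x in 𝓝 z, gridWeight w θ h (fun i => (round (h⁻¹ * θ z i) : ZMod 2))
      (fun i => round (h⁻¹ * θ z i)) x = 1 := by
  have h1 : ‖h⁻¹ • θ z - fun i => (round (h⁻¹ * θ z i) : ℝ)‖ < 5 / 8 := by
    refine lt_of_le_of_lt ((pi_norm_le_iff_of_nonneg (by norm_num : (0 : ℝ) ≤ 1 / 2)).2 fun i => ?_)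
      (by norm_num)
    exact abs_sub_round (h⁻¹ * θ z i)
  have h2 : Continuous fun x => ‖h⁻¹ • θ x - fun i => (round (h⁻¹ * θ z i) : ℝ)‖ := by fun_prop
  filter_upwards [hw, h2.continuousAt.eventually_lt_const h1] with x hx hx'
  rw [gridWeight, if_pos rfl, hx, cubeBump_eq_one hx'.le, one_mul]

end gridWeight

section FiniteDimensional

variable {Z Y ι : Type*} [MetricSpace Z] [MetricSpace Y] [Fintype ι] {w : Z → ℝ} {θ : Z → ι → ℝ}

/-- One parity class after the other: `l` lists the classes that are still to be treated. The map
`G` is the current one; it is close to the original map `F`, which oscillates little on the sets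
that are small in the coordinates `θ`. The number of classes does not depend on the scale `h`, so
the tolerance `δ` for the start is chosen before `h`. -/
theorem exists_locallyLipschitzAt_of_parity_mem (hY : LocallyLipschitzContractible Y)
    {A B : NNReal} (hw : ∀ z, 0 ≤ w z) (hw1 : ∀ z, w z ≤ 1) (hwl : LipschitzWith A w)
    (hθ : LipschitzWith B θ) {N : Set Z} (hwN : ∀ z ∉ N, w z = 0) {F : Z → Y} {Q : Set Y}
    (hQ : IsCompact Q) (hFQ : ∀ z ∈ N, F z ∈ Q) (l : List (ι → ZMod 2)) :
    ∀ ε > 0, ∃ δ > 0, ∀ h > 0, (∀ z ∈ N, ∀ z' ∈ N, dist (θ z) (θ z') < 2 * h →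
      dist (F z) (F z') < δ) → ∀ G : Z → Y, Continuous G → (∀ z ∈ N, dist (G z) (F z) < δ) →
      ∃ G' : Z → Y, Continuous G' ∧ (∀ z ∉ N, G' z = G z) ∧ (∀ z ∈ N, dist (G' z) (F z) < ε) ∧
        (∀ z, LocallyLipschitzAt G z → LocallyLipschitzAt G' z) ∧
        ∀ z, (∀ᶠ x in 𝓝 z, w x = 1) → (fun i => (round (h⁻¹ * θ z i) : ZMod 2)) ∈ l →
          LocallyLipschitzAt G' z := by
  induction l with
  | nil =>
    exact fun ε hε => ⟨ε, hε, fun h _ _ G hG hGF => ⟨G, hG, fun _ _ => rfl, hGF, fun _ h => h,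
      by simp⟩⟩
  | cons κ l ih =>
    intro ε hε
    obtain ⟨δ₁, hδ₁, H⟩ := ih ε hε
    obtain ⟨δ₂, hδ₂, L, hL, hΦ⟩ := hY.exists_uniform hQ (half_pos hδ₁)
    refine ⟨min (δ₁ / 2) (δ₂ / 2), lt_min (half_pos hδ₁) (half_pos hδ₂), fun h hh hosc G hG hGF => ?_⟩
    rcases isEmpty_or_nonempty Z with _ | ⟨⟨z₁⟩⟩
    · exact ⟨G, hG, isEmptyElim, isEmptyElim, isEmptyElim, isEmptyElim⟩
    have hwN' : ∀ z, 0 < w z → z ∈ N := fun z hz => by_contra fun hn => hz.ne' (hwN z hn)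
    have hex : ∀ c : ι → ℤ, ∃ q Φ p, ∀ z, 0 < gridWeight w θ h κ c z →
        IsLipContraction L (Metric.ball q δ₂) (Metric.ball q (δ₁ / 2)) Φ p ∧
          dist (F z) q < min (δ₁ / 2) (δ₂ / 2) := by
      intro c
      by_cases e : ∃ z, 0 < gridWeight w θ h κ c z
      · obtain ⟨z₀, hz₀⟩ := e
        have hN := hwN' _ (of_gridWeight_pos hw hz₀).2.1
        obtain ⟨Φ, p, hp⟩ := hΦ _ (hFQ z₀ hN)
        exact ⟨F z₀, Φ, p, fun z hz => ⟨hp, hosc _ (hwN' _ (of_gridWeight_pos hw hz).2.1) _ hN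
          (dist_lt_of_gridWeight_pos hw hh hz hz₀)⟩⟩
      · exact ⟨F z₁, fun y _ => y, F z₁, fun z hz => (e ⟨z, hz⟩).elim⟩
    choose q Φ p hqΦ using hex
    have hV : ∀ c z, 0 < gridWeight w θ h κ c z → G z ∈ Metric.ball (q c) δ₂ := fun c z hz => by
      have h1 := (hqΦ c z hz).2.trans_le (min_le_right _ _)
      have h2 := (hGF z (hwN' _ (of_gridWeight_pos hw hz).2.1)).trans_le (min_le_right _ _)
      rw [Metric.mem_ball]
      linarith [dist_triangle (G z) (F z) (q c)]
    have hu : ∀ z c c', 0 < gridWeight w θ h κ c z → 0 < gridWeight w θ h κ c' z → c = c' :=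
      fun z c c' => eq_of_gridWeight_pos hw
    let G₁ : Z → Y := fun z => levelMap Φ (gridWeight w θ h κ · z) (G z)
    have hdist := dist_levelMap_comp_le (a := gridWeight w θ h κ) (G := G) hL
      (fun c z hz => (hqΦ c z hz).1) (fun _ _ => gridWeight_nonneg hw)
      (fun _ _ => gridWeight_le_one hw1) hu
      (fun _ _ _ => abs_gridWeight_sub_le hw hw1 hwl hθ hh) hV
    have hG₁ : Continuous G₁ := continuous_of_dist_le_max hG hdist
    have hzero : ∀ z, (∀ c, ¬ 0 < gridWeight w θ h κ c z) → G₁ z = G z := fun z hz =>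
      levelMap_of_forall_le fun c => not_lt.1 (hz c)
    have hG₁F : ∀ z ∈ N, dist (G₁ z) (F z) < δ₁ := by
      intro z hz
      by_cases e : ∃ c, 0 < gridWeight w θ h κ c z
      · obtain ⟨c, hc⟩ := e
        have h1 : G₁ z ∈ Metric.ball (q c) (δ₁ / 2) := by
          simp only [G₁]
          rw [levelMap_eq (a := (gridWeight w θ h κ · z)) hc fun c' hc' => hu z _ _ hc' hc]
          exact (hqΦ c z hc).1.mem _ (hV c z hc) _ ⟨hc.le, gridWeight_le_one hw1⟩
        have h2 := (hqΦ c z hc).2.trans_le (min_le_left _ _)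
        rw [Metric.mem_ball] at h1
        linarith [dist_triangle_right (G₁ z) (F z) (q c)]
      · push Not at e
        rw [hzero z fun c => not_lt.2 (e c)]
        exact (hGF z hz).trans_le ((min_le_left _ _).trans (by linarith))
    obtain ⟨G', c1, c2, c3, c4, c5⟩ := H h hh (fun z hz z' hz' hd => (hosc z hz z' hz' hd).trans_le
      ((min_le_left _ _).trans (by linarith))) G₁ hG₁ hG₁F
    have hoff : ∀ z ∉ N, G₁ z = G z := fun z hz =>
      hzero z fun c hc => hz (hwN' _ (of_gridWeight_pos hw hc).2.1)
    refine ⟨G', c1, fun z hz => (c2 z hz).trans (hoff z hz), c3,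
      fun z hz => c4 z (hz.of_dist_le_max (by linarith) hdist), fun z hz hm => ?_⟩
    rcases List.mem_cons.1 hm with rfl | hm
    · -- Near `z` the weight of one fixed integer point is `1`, so `G₁` is constant there.
      refine c4 z ((locallyLipschitzAt_const (p fun i => round (h⁻¹ * θ z i)) z).congr ?_)
      filter_upwards [eventually_gridWeight_eq_one (h := h) hθ.continuous hz] with x hx
      simp only [G₁]
      have hx0 := hx.symm ▸ one_pos
      rw [levelMap_eq (a := (gridWeight w θ h _ · x)) hx0 fun c' hc' => hu x _ _ hc' hx0, hx,
        (hqΦ _ x hx0).1.one _ (hV _ x hx0)]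
    · exact c5 z hz hm

/-- A continuous map can be changed on a relatively compact set `N` with Lipschitz coordinates
`θ` in a finite-dimensional space so as to become locally Lipschitz where the cut-off `w` is
locally `1`, and to stay locally Lipschitz where it was. -/
theorem exists_locallyLipschitzAt_of_eventually_eq_one (hY : LocallyLipschitzContractible Y)
    {A B : NNReal} (hw : ∀ z, 0 ≤ w z) (hw1 : ∀ z, w z ≤ 1) (hwl : LipschitzWith A w)
    (hθ : LipschitzWith B θ) {N D : Set Z} (hwN : ∀ z ∉ N, w z = 0) (hD : IsCompact D)
    (hND : N ⊆ D) (hθD : ∀ z ∈ D, ∀ z' ∈ D, dist z z' ≤ dist (θ z) (θ z')) {F : Z → Y}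
    (hF : Continuous F) :
    ∃ G : Z → Y, Continuous G ∧ (∀ z ∉ N, G z = F z) ∧
      (∀ z, LocallyLipschitzAt F z → LocallyLipschitzAt G z) ∧
      ∀ z, (∀ᶠ x in 𝓝 z, w x = 1) → LocallyLipschitzAt G z := by
  classical
  obtain ⟨δ, hδ, H⟩ := exists_locallyLipschitzAt_of_parity_mem hY hw hw1 hwl hθ hwN
    (hD.image hF) (fun z hz => mem_image_of_mem F (hND hz))
    (Finset.univ : Finset (ι → ZMod 2)).toList 1 one_pos
  obtain ⟨η, hη, hunif⟩ := Metric.uniformContinuousOn_iff.1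
    (hD.uniformContinuousOn_of_continuous hF.continuousOn) δ hδ
  obtain ⟨G, h1, h2, -, h4, h5⟩ := H (η / 2) (half_pos hη) (fun z hz z' hz' hd =>
    hunif z (hND hz) z' (hND hz') ((hθD z (hND hz) z' (hND hz')).trans_lt (by linarith))) F hF
    (fun z _ => by simpa using hδ)
  exact ⟨G, h1, h2, h4, fun z hz => h5 z hz (by simp)⟩

end FiniteDimensional

/-- The limit of successive changes supported in a locally finite sequence of sets. -/
theorem exists_locallyLipschitzAt_of_locallyFinite {Z Y : Type*} [MetricSpace Z] [MetricSpace Y]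
    {N C : ℕ → Set Z} (hN : LocallyFinite N)
    (hstep : ∀ n, ∀ F : Z → Y, Continuous F → ∃ G : Z → Y, Continuous G ∧ (∀ z ∉ N n, G z = F z) ∧
      (∀ z, LocallyLipschitzAt F z → LocallyLipschitzAt G z) ∧ ∀ z ∈ C n, LocallyLipschitzAt G z)
    {F : Z → Y} (hF : Continuous F) :
    ∃ G : Z → Y, Continuous G ∧ (∀ z, (∀ n, z ∉ N n) → G z = F z) ∧
      (∀ z, LocallyLipschitzAt F z → LocallyLipschitzAt G z) ∧
      ∀ z ∈ ⋃ n, C n, LocallyLipschitzAt G z := by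
  choose! step s1 s2 s3 s4 using hstep
  let G : ℕ → Z → Y := fun n => n.rec F step
  have hG : ∀ n, Continuous (G n) := fun n => by
    induction n with
    | zero => exact hF
    | succ n ih => exact s1 n _ ih
  have hst : ∀ n m, n ≤ m → ∀ z, (∀ k, n ≤ k → z ∉ N k) → G m z = G n z := by
    intro n m hnm z hz
    induction m, hnm using Nat.le_induction with
    | base => rfl
    | succ m hm ih => exact (s2 m _ (hG m) z (hz m hm)).trans ih
  have hL : ∀ n m, n ≤ m → ∀ z, LocallyLipschitzAt (G n) z → LocallyLipschitzAt (G m) z := by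
    intro n m hnm z hz
    induction m, hnm using Nat.le_induction with
    | base => exact hz
    | succ m hm ih => exact s3 m _ (hG m) z ih
  have hloc : ∀ z, ∃ O ∈ 𝓝 z, ∃ n, ∀ x ∈ O, ∀ k, n ≤ k → x ∉ N k := by
    intro z
    obtain ⟨O, hO, hfin⟩ := hN z
    obtain ⟨n, hn⟩ := hfin.bddAbove
    exact ⟨O, hO, n + 1, fun x hx k hk hxk => absurd (hn ⟨x, hxk, hx⟩) (by omega)⟩
  choose O hO n hn using hloc
  have heq : ∀ z m, n z ≤ m → (fun x => G (n x) x) =ᶠ[𝓝 z] G m := by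
    intro z m hm
    filter_upwards [hO z] with x hx
    rcases le_total (n x) m with h | h
    · exact (hst _ _ h x (hn x x (mem_of_mem_nhds (hO x)))).symm
    · exact hst _ _ h x fun k hk => hn z x hx k (hm.trans hk)
  refine ⟨fun x => G (n x) x, ?_, fun z hz => ?_, fun z hz => ?_, fun z hz => ?_⟩
  · exact continuous_iff_continuousAt.2 fun z => (hG (n z)).continuousAt.congr (heq z _ le_rfl).symm
  · exact hst 0 _ (Nat.zero_le _) z fun k _ => hz k
  · exact (hL 0 (n z) (Nat.zero_le _) z hz).congr (heq z _ le_rfl).symm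
  · obtain ⟨k, hk⟩ := mem_iUnion.1 hz
    exact (hL (k + 1) _ (le_max_right (n z) (k + 1)) z (s4 k _ (hG k) z hk)).congr
      (heq z _ (le_max_left _ _)).symm

/-! ### The nerve of a good covering -/

section IsGoodCovering

variable {X : Type u} {J : Type w} {U : J → Set X}

theorem IsGoodCovering.finite_setOf_inter_nonempty [MetricSpace X] (hU : IsGoodCovering U) (j : J) :
    {i | (U i ∩ U j).Nonempty}.Finite :=
  (hU.locallyFinite.finite_nonempty_inter_compact (hU.isCompact_closure j)).subset
    fun _ h => h.mono (inter_subset_inter_right _ subset_closure)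

/-- The geometric realization of the nerve of `U`, inside `ℓ^∞(J)`. The coordinates of a point are
non-negative and their maximum (rather than their sum) is `1`. -/
def nerve (U : J → Set X) : Set (lp (fun _ : J => ℝ) ⊤) :=
  {x | (∀ j, 0 ≤ x j) ∧ ‖x‖ = 1 ∧ ∀ s : Finset J, (∀ i ∈ s, 0 < x i) → (⋂ i ∈ s, U i).Nonempty}

theorem abs_lp_apply_sub_le (x y : lp (fun _ : J => ℝ) ⊤) (j : J) : |x j - y j| ≤ dist x y := by
  rw [dist_eq_norm, ← Real.norm_eq_abs]
  exact lp.norm_apply_le_norm ENNReal.top_ne_zero (x - y) j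

theorem continuous_lp_apply (j : J) : Continuous fun x : lp (fun _ : J => ℝ) ⊤ => x j :=
  (LipschitzWith.of_dist_le_mul (K := 1) fun x y => by
    rw [NNReal.coe_one, one_mul, Real.dist_eq]; exact abs_lp_apply_sub_le x y j).continuous

theorem isClosed_nerve : IsClosed (nerve U) := by
  have e : nerve U = (⋂ j, {x | 0 ≤ x j}) ∩ ({x | ‖x‖ = 1} ∩ ⋂ s : Finset J,
      {x | (∀ i ∈ s, 0 < x i) → (⋂ i ∈ s, U i).Nonempty}) := by
    ext x
    simp [nerve]
  rw [e]
  refine (isClosed_iInter fun j => isClosed_le continuous_const (continuous_lp_apply j)).inter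
    ((isClosed_eq continuous_norm continuous_const).inter (isClosed_iInter fun s => ?_))
  by_cases h : (⋂ i ∈ s, U i).Nonempty
  · simp [h]
  · have : {x : lp (fun _ : J => ℝ) ⊤ | (∀ i ∈ s, 0 < x i) → (⋂ i ∈ s, U i).Nonempty} =
        (⋂ i ∈ s, {x | 0 < x i})ᶜ := by
      ext x
      simp [h]
    rw [this, isClosed_compl_iff]
    exact isOpen_biInter_finset fun i _ => isOpen_lt continuous_const (continuous_lp_apply i)

theorem inter_nonempty_of_mem_nerve {x : lp (fun _ : J => ℝ) ⊤} (hx : x ∈ nerve U) {i j : J}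
    (hi : 0 < x i) (hj : 0 < x j) : (U i ∩ U j).Nonempty := by
  classical
  have := hx.2.2 {i, j} (by simp [hi, hj])
  simpa using this

theorem exists_apply_eq_one [MetricSpace X] (hU : IsGoodCovering U) {x : lp (fun _ : J => ℝ) ⊤}
    (hx : x ∈ nerve U) : ∃ j, x j = 1 := by
  obtain ⟨j₀, hj₀⟩ : ∃ j, 0 < x j := by
    by_contra! h
    have : ‖x‖ ≤ 0 := lp.norm_le_of_forall_le le_rfl fun j => by
      rw [le_antisymm (h j) (hx.1 j), norm_zero]
    linarith [hx.2.1]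
  let A := (hU.finite_setOf_inter_nonempty j₀).toFinset
  have hA : ∀ i, 0 < x i → i ∈ A := fun i hi =>
    (hU.finite_setOf_inter_nonempty j₀).mem_toFinset.2 (inter_nonempty_of_mem_nerve hx hi hj₀)
  obtain ⟨j, -, hj⟩ := A.exists_max_image x ⟨j₀, hA j₀ hj₀⟩
  refine ⟨j, le_antisymm ?_ ?_⟩
  · rw [← hx.2.1]
    exact (le_abs_self _).trans (lp.norm_apply_le_norm ENNReal.top_ne_zero x j)
  · rw [← hx.2.1]
    refine lp.norm_le_of_forall_le (hx.1 j) fun i => ?_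
    rw [Real.norm_of_nonneg (hx.1 i)]
    by_cases hi : 0 < x i
    · exact hj i (hA i hi)
    · exact (not_lt.1 hi).trans (hx.1 j)

/-- Near the vertex `j` the nerve is finite-dimensional: a point with positive coordinate `j` is
determined, together with its distances, by the finitely many coordinates of the neighbours
of `j`. -/
theorem dist_le_dist_restrict {x y : lp (fun _ : J => ℝ) ⊤} (hx : x ∈ nerve U) (hy : y ∈ nerve U)
    {j : J} {A : Finset J} (hA : ∀ i, (U i ∩ U j).Nonempty → i ∈ A) (hxj : 0 < x j)
    (hyj : 0 < y j) : dist x y ≤ dist (fun i : A => x i) (fun i : A => y i) := by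
  rw [dist_eq_norm]
  refine lp.norm_le_of_forall_le dist_nonneg fun i => ?_
  by_cases hi : i ∈ A
  · rw [lp.coeFn_sub, Pi.sub_apply, ← dist_eq_norm]
    exact dist_le_pi_dist (fun i : A => x i) (fun i : A => y i) ⟨i, hi⟩
  · have h0 : ∀ {z : lp (fun _ : J => ℝ) ⊤}, z ∈ nerve U → 0 < z j → z i = 0 := fun hz hzj =>
      le_antisymm (not_lt.1 fun h => hi (hA i (inter_nonempty_of_mem_nerve hz h hzj))) (hz.1 i)
    rw [lp.coeFn_sub, Pi.sub_apply, h0 hx hxj, h0 hy hyj, sub_zero, norm_zero]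
    exact dist_nonneg

open Classical in
theorem isCompact_setOf_le_apply [MetricSpace X] (hU : IsGoodCovering U) (j : J) :
    IsCompact {x : nerve U | 1 / 2 ≤ x.1 j} := by
  let A : Finset J := (hU.finite_setOf_inter_nonempty j).toFinset
  have hmem : ∀ v : A → ℝ, Memℓp (fun i => if h : i ∈ A then v ⟨i, h⟩ else 0 : J → ℝ) ⊤ :=
    fun v => memℓp_infty ⟨‖v‖, by
      rintro _ ⟨i, rfl⟩
      dsimp only
      split_ifs with h
      · exact norm_le_pi_norm v _
      · simp⟩
  let e : (A → ℝ) → lp (fun _ : J => ℝ) ⊤ := fun v => ⟨_, hmem v⟩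
  have he : Continuous e := by
    refine (LipschitzWith.of_dist_le_mul (K := 1) fun v v' => ?_).continuous
    rw [NNReal.coe_one, one_mul, dist_eq_norm]
    refine lp.norm_le_of_forall_le dist_nonneg fun i => ?_
    simp only [e, lp.coeFn_sub, Pi.sub_apply]
    split_ifs with h
    · rw [← dist_eq_norm]
      exact dist_le_pi_dist v v' _
    · simp
  rw [Subtype.isCompact_iff]
  have hcl : IsClosed (nerve U ∩ {x | 1 / 2 ≤ x j}) :=
    isClosed_nerve.inter (isClosed_le continuous_const (continuous_lp_apply j))
  refine ((isCompact_closedBall (0 : A → ℝ) 1).image he).of_isClosed_subset (t := _) ?_ ?_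
  · convert hcl using 1
    exact Subtype.image_preimage_coe (nerve U) {x | 1 / 2 ≤ x j}
  · rintro _ ⟨x, hx, rfl⟩
    have hxj : 0 < x.1 j := lt_of_lt_of_le (by norm_num) hx
    refine ⟨fun i => x.1 i, ?_, ?_⟩
    · rw [mem_closedBall_zero_iff]
      refine (pi_norm_le_iff_of_nonneg zero_le_one).2 fun i => ?_
      exact (lp.norm_apply_le_norm ENNReal.top_ne_zero x.1 i).trans x.2.2.1.le
    · ext i
      simp only [e]
      split_ifs with h
      · rfl
      · exact le_antisymm (x.2.1 i) (not_lt.1 fun hp => h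
          ((hU.finite_setOf_inter_nonempty j).mem_toFinset.2
            (inter_nonempty_of_mem_nerve x.2 hp hxj)))

/-- A continuous map on the product of the nerve with the interval can be changed away from the
ends so as to become locally Lipschitz in the middle, and to stay locally Lipschitz where it
was. -/
theorem exists_locallyLipschitzAt_nerve_prod [MetricSpace X] (hU : IsGoodCovering U) [Countable J]
    {Y : Type v} [MetricSpace Y] (hY : LocallyLipschitzContractible Y) {F : nerve U × I → Y}
    (hF : Continuous F) :
    ∃ G : nerve U × I → Y, Continuous G ∧ (∀ x, G (x, 0) = F (x, 0)) ∧
      (∀ x, G (x, 1) = F (x, 1)) ∧ (∀ z, LocallyLipschitzAt F z → LocallyLipschitzAt G z) ∧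
      ∀ z : nerve U × I, 1 / 4 ≤ (z.2 : ℝ) → (z.2 : ℝ) ≤ 3 / 4 → LocallyLipschitzAt G z := by
  classical
  obtain ⟨_⟩ := nonempty_encodable J
  let N : J → Set (nerve U × I) := fun j => {z | 1 / 2 < z.1.1 j ∧ 1 / 8 < (z.2 : ℝ) ∧
    (z.2 : ℝ) < 7 / 8}
  let C : J → Set (nerve U × I) := fun j => {z | 3 / 4 < z.1.1 j ∧ 1 / 4 ≤ (z.2 : ℝ) ∧
    (z.2 : ℝ) ≤ 3 / 4}
  have hstep : ∀ j, ∀ F : nerve U × I → Y, Continuous F → ∃ G : nerve U × I → Y, Continuous G ∧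
      (∀ z ∉ N j, G z = F z) ∧ (∀ z, LocallyLipschitzAt F z → LocallyLipschitzAt G z) ∧
      ∀ z ∈ C j, LocallyLipschitzAt G z := by
    intro j F hF
    let A : Finset J := (hU.finite_setOf_inter_nonempty j).toFinset
    have hA : ∀ i, (U i ∩ U j).Nonempty → i ∈ A := fun i hi =>
      (hU.finite_setOf_inter_nonempty j).mem_toFinset.2 hi
    let θ : nerve U × I → Option A → ℝ := fun z o => o.elim (z.2 : ℝ) fun i => z.1.1 i
    let m : nerve U × I → ℝ := fun z =>
      min (16 * (z.1.1 j - 1 / 2)) (min (16 * ((z.2 : ℝ) - 1 / 8)) (16 * (7 / 8 - (z.2 : ℝ))))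
    have d1 : ∀ (z z' : nerve U × I) i, |z.1.1 i - z'.1.1 i| ≤ dist z z' := fun z z' i =>
      (abs_lp_apply_sub_le _ _ i).trans (le_max_left _ _)
    have d2 : ∀ z z' : nerve U × I, |(z.2 : ℝ) - z'.2| ≤ dist z z' := fun z z' => le_max_right _ _
    have hm : ∀ z z', |m z - m z'| ≤ 16 * dist z z' := by
      intro z z'
      have a1 := d1 z z' j
      have a2 := d2 z z'
      refine (abs_min_sub_min_le_max _ _ _ _).trans (max_le ?_
        ((abs_min_sub_min_le_max _ _ _ _).trans (max_le ?_ ?_)))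
      all_goals
        rw [abs_le] at *
        constructor <;> linarith [a1.1, a1.2, a2.1, a2.2]
    have hw : LipschitzWith 16 fun z => max 0 (min 1 (m z)) :=
      LipschitzWith.of_dist_le_mul fun z z' => (abs_clamp_sub_clamp_le _ _).trans (hm z z')
    have hθ : LipschitzWith 1 θ := by
      refine LipschitzWith.of_dist_le_mul fun z z' => ?_
      rw [NNReal.coe_one, one_mul]
      refine (dist_pi_le_iff dist_nonneg).2 fun o => ?_
      rcases o with _ | i
      · exact d2 z z'
      · exact d1 z z' i
    have hD : IsCompact ({x : nerve U | 1 / 2 ≤ x.1 j} ×ˢ (univ : Set I)) :=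
      (isCompact_setOf_le_apply hU j).prod isCompact_univ
    have hwN : ∀ z ∉ N j, max 0 (min 1 (m z)) = 0 := by
      refine fun z hz => max_eq_left ((min_le_right _ _).trans (not_lt.1 fun h => hz ?_))
      simp only [m, lt_min_iff] at h
      exact ⟨by linarith, by linarith, by linarith⟩
    have hθD : ∀ z ∈ {x : nerve U | 1 / 2 ≤ x.1 j} ×ˢ (univ : Set I),
        ∀ z' ∈ {x : nerve U | 1 / 2 ≤ x.1 j} ×ˢ (univ : Set I),
        dist z z' ≤ dist (θ z) (θ z') := by
      refine fun z hz z' hz' => max_le ?_ (dist_le_pi_dist (θ z) (θ z') none)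
      refine (dist_le_dist_restrict z.1.2 z'.1.2 hA (lt_of_lt_of_le (by norm_num) hz.1)
        (lt_of_lt_of_le (by norm_num) hz'.1)).trans ?_
      exact (dist_pi_le_iff dist_nonneg).2 fun i => dist_le_pi_dist (θ z) (θ z') (some i)
    obtain ⟨G, g1, g2, g3, g4⟩ := exists_locallyLipschitzAt_of_eventually_eq_one hY
      (fun z => le_max_left _ _) (fun z => max_le zero_le_one (min_le_left _ _)) hw hθ hwN hD
      (fun z hz => ⟨hz.1.le, mem_univ _⟩) hθD hF
    refine ⟨G, g1, g2, g3, fun z hz => g4 z ?_⟩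
    have hmc : Continuous m := by
      have := (continuous_lp_apply j).comp (continuous_subtype_val.comp
        (continuous_fst : Continuous fun z : nerve U × I => z.1))
      simp only [Function.comp_def] at this
      fun_prop
    have : 1 < m z := by
      obtain ⟨h1, h2, h3⟩ := hz
      refine lt_min ?_ (lt_min ?_ ?_) <;> linarith
    filter_upwards [hmc.continuousAt.eventually_const_lt this] with x hx
    rw [min_eq_left hx.le, max_eq_right zero_le_one]
  have hfin : LocallyFinite N := by
    intro z
    obtain ⟨j, hj⟩ := exists_apply_eq_one hU z.1.2
    refine ⟨_, Metric.ball_mem_nhds z one_pos, (hU.finite_setOf_inter_nonempty j).subset ?_⟩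
    rintro i ⟨x, hxi, hx⟩
    refine inter_nonempty_of_mem_nerve x.1.2 (lt_trans (by norm_num) hxi.1) ?_
    have h1 := ((abs_lp_apply_sub_le x.1.1 z.1.1 j).trans (le_max_left _ _)).trans_lt hx
    rw [hj] at h1
    linarith [(abs_lt.1 h1).1]
  have hfin' : LocallyFinite fun n => {z | ∃ j, Encodable.encode j = n ∧ z ∈ N j} := by
    intro z
    obtain ⟨O, hO, hf⟩ := hfin z
    refine ⟨O, hO, (hf.image Encodable.encode).subset ?_⟩
    rintro n ⟨x, ⟨j, rfl, hj⟩, hx⟩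
    exact ⟨j, ⟨x, hj, hx⟩, rfl⟩
  obtain ⟨G, g1, g2, g3, g4⟩ := exists_locallyLipschitzAt_of_locallyFinite
    (C := fun n => {z | ∃ j, Encodable.encode j = n ∧ z ∈ C j}) hfin' (fun n F hF => by
      by_cases h : ∃ j : J, Encodable.encode j = n
      · obtain ⟨j, rfl⟩ := h
        simpa using hstep j F hF
      · push Not at h
        exact ⟨F, hF, fun _ _ => rfl, fun _ h => h, fun z ⟨j, hj, _⟩ => (h j hj).elim⟩) hF
  refine ⟨G, g1, fun x => g2 _ ?_, fun x => g2 _ ?_, g3, fun z h1 h2 => g4 z ?_⟩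
  · rintro n ⟨j, -, -, h, -⟩
    norm_num at h
  · rintro n ⟨j, -, -, -, h⟩
    norm_num at h
  · obtain ⟨j, hj⟩ := exists_apply_eq_one hU z.1.2
    exact mem_iUnion.2 ⟨_, j, rfl, by rw [hj]; norm_num, h1, h2⟩

end IsGoodCovering

/-! ### Weights of simplices -/

section simplexWeight

variable {J : Type w}

/-- The points of `ℓ^∞(J)` at which it is not the case that the coordinates in `s` are positive and
larger than all others. -/
def gapSet (s : Finset J) : Set (lp (fun _ : J => ℝ) ⊤) :=
  {x | ∃ j ∈ s, x j ≤ 0 ∨ ∃ k ∉ s, x j ≤ x k}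

/-- The weight of the simplex `s` at a point `x`: it measures how much larger the coordinates in `s`
are than the others. The simplices with positive weight at `x` form a chain (a simplex of the
barycentric subdivision); the factor makes some weight equal to `1`. For `s = ∅` the weight is `0`,
since the distance to the empty set is `0` by convention. -/
noncomputable def simplexWeight (s : Finset J) (x : lp (fun _ : J => ℝ) ⊤) : ℝ :=
  min 1 (2 ^ (s.card + 1) * Metric.infDist x (gapSet s))

variable {s s' : Finset J} {x : lp (fun _ : J => ℝ) ⊤}

theorem simplexWeight_nonneg : 0 ≤ simplexWeight s x :=
  le_min zero_le_one (mul_nonneg (by positivity) Metric.infDist_nonneg)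

theorem simplexWeight_le_one : simplexWeight s x ≤ 1 := min_le_left _ _

theorem abs_simplexWeight_sub_le (s : Finset J) (x y : lp (fun _ : J => ℝ) ⊤) :
    |simplexWeight s x - simplexWeight s y| ≤ 2 ^ (s.card + 1) * dist x y := by
  refine (abs_min_sub_min_le_max _ _ _ _).trans (max_le (by rw [sub_self, abs_zero]; positivity) ?_)
  rw [← mul_sub, abs_mul, abs_of_nonneg (by positivity : (0 : ℝ) ≤ 2 ^ (s.card + 1))]
  refine mul_le_mul_of_nonneg_left ?_ (by positivity)
  exact (Metric.lipschitz_infDist_pt (gapSet s)).dist_le_mul x y |>.trans (by simp)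

theorem of_simplexWeight_pos (h : 0 < simplexWeight s x) :
    s.Nonempty ∧ ∀ j ∈ s, 0 < x j ∧ ∀ k ∉ s, x k < x j := by
  have h1 : 0 < Metric.infDist x (gapSet s) :=
    pos_of_mul_pos_right (h.trans_le (min_le_right _ _)) (by positivity)
  constructor
  · by_contra h2
    rw [Finset.not_nonempty_iff_eq_empty] at h2
    subst h2
    simp [gapSet] at h1
  · have hx : x ∉ gapSet s := fun hx => h1.ne' (Metric.infDist_zero_of_mem hx)
    simpa [gapSet] using hx

theorem subset_or_subset_of_simplexWeight_pos (h : 0 < simplexWeight s x)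
    (h' : 0 < simplexWeight s' x) : s ⊆ s' ∨ s' ⊆ s := by
  by_contra! hc
  obtain ⟨⟨j, hj, hj'⟩, ⟨k, hk, hk'⟩⟩ := And.imp Finset.not_subset.1 Finset.not_subset.1 hc
  exact lt_asymm (((of_simplexWeight_pos h).2 j hj).2 k hk')
    (((of_simplexWeight_pos h').2 k hk).2 j hj')

theorem simplexWeight_eq_one (hs : s.Nonempty)
    (h : ∀ j ∈ s, 2⁻¹ ^ s.card ≤ x j ∧ ∀ k ∉ s, 2⁻¹ ^ s.card ≤ x j - x k) :
    simplexWeight s x = 1 := by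
  refine min_eq_left ?_
  have hne : (gapSet s).Nonempty := by
    obtain ⟨j, hj⟩ := hs
    exact ⟨0, j, hj, Or.inl (by simp)⟩
  have : (2⁻¹ : ℝ) ^ (s.card + 1) ≤ Metric.infDist x (gapSet s) := by
    refine (Metric.le_infDist hne).2 fun y hy => ?_
    rw [pow_succ]
    have hp : (0 : ℝ) < 2⁻¹ ^ s.card := by positivity
    obtain ⟨j, hj, hy | ⟨k, hk, hy⟩⟩ := hy
    · have h1 := (abs_le.1 (abs_lp_apply_sub_le x y j)).2
      linarith [(h j hj).1]
    · have h1 := (abs_le.1 (abs_lp_apply_sub_le x y j)).2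
      have h2 := (abs_le.1 (abs_lp_apply_sub_le x y k)).1
      linarith [(h j hj).2 k hk]
  calc (1 : ℝ) = 2 ^ (s.card + 1) * 2⁻¹ ^ (s.card + 1) := by rw [← mul_pow]; norm_num
    _ ≤ _ := mul_le_mul_of_nonneg_left this (by positivity)

/-- If all gaps between consecutive values of the coordinates were small (the `d`-th one smaller
than `2⁻ᵈ`), then the coordinates, starting from the largest one, which is `1`, would never get
down to `0`. -/
theorem exists_simplexWeight_eq_one (h0 : ∀ j, 0 ≤ x j) (hfin : {j | 0 < x j}.Finite)
    (h1 : ∃ j, x j = 1) : ∃ s, simplexWeight s x = 1 := by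
  classical
  by_contra! hne
  have key : ∀ d : ℕ, ∃ s : Finset J, s.card = d ∧ (∀ j ∈ s, ∀ k ∉ s, x k ≤ x j) ∧
      ∃ k ∉ s, (2⁻¹ : ℝ) ^ d ≤ x k := by
    intro d
    induction d with
    | zero =>
      obtain ⟨j, hj⟩ := h1
      exact ⟨∅, rfl, by simp, j, by simp, by simp [hj]⟩
    | succ d ih =>
      obtain ⟨s, rfl, hs, k₀, hk₀, hk₀x⟩ := ih
      have hp : (0 : ℝ) < 2⁻¹ ^ s.card := by positivity
      obtain ⟨k, hk, hkmax⟩ := (hfin.toFinset \ s).exists_max_image x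
        ⟨k₀, by simp [hk₀, hp.trans_le hk₀x]⟩
      have hks : k ∉ s := (Finset.mem_sdiff.1 hk).2
      have hkm : ∀ l ∉ s, x l ≤ x k := by
        intro l hl
        by_cases hl0 : 0 < x l
        · exact hkmax l (by simp [hl, hl0])
        · exact (not_lt.1 hl0).trans (h0 k)
      have hkx : (2⁻¹ : ℝ) ^ s.card ≤ x k := hk₀x.trans (hkm k₀ hk₀)
      have hge : ∀ j ∈ insert k s, x k ≤ x j := by
        intro j hj
        rcases Finset.mem_insert.1 hj with rfl | hj
        · exact le_rfl
        · exact hs j hj k hks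
      have hcard : (insert k s).card = s.card + 1 := Finset.card_insert_of_notMem hks
      refine ⟨insert k s, hcard, fun j hj l hl => ?_, ?_⟩
      · exact (hkm l fun h => hl (Finset.mem_insert_of_mem h)).trans (hge j hj)
      · by_contra! hlt
        have e : (2⁻¹ : ℝ) ^ (s.card + 1) = 2⁻¹ ^ s.card * 2⁻¹ := pow_succ _ _
        refine hne (insert k s) (simplexWeight_eq_one ⟨k, Finset.mem_insert_self k s⟩
          fun j hj => ?_)
        rw [hcard]
        exact ⟨by linarith [hge j hj], fun l hl => by linarith [hge j hj, hlt l hl]⟩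
  obtain ⟨s, hs, hsk, k, hk, hkx⟩ := key hfin.toFinset.card
  have hk0 : 0 < x k := lt_of_lt_of_le (by positivity) hkx
  have : insert k s ⊆ hfin.toFinset := by
    intro j hj
    rw [hfin.mem_toFinset]
    rcases Finset.mem_insert.1 hj with rfl | hj
    · exact hk0
    · exact hk0.trans_le (hsk j hj k hk)
  have := Finset.card_le_card this
  rw [Finset.card_insert_of_notMem hk] at this
  omega

end simplexWeight

/-! ### Descending through a flag of simplices -/

section descend

variable {X : Type u} {J : Type w}

open Classical in
/-- The part of a weight function that sits on the simplices with `n` vertices. -/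
noncomputable def levelWeight (a : Finset J → ℝ) (n : ℕ) (s : Finset J) : ℝ :=
  if s.card = n then a s else 0

/-- Apply the contractions `Φ s`, for the times `a s`, to a point: the one for the simplex with `n`
vertices comes first, the one for the vertex last. -/
noncomputable def descend (Φ : Finset J → X → ℝ → X) (a : Finset J → ℝ) : ℕ → X → X
  | 0, x => x
  | n + 1, x => descend Φ a n (levelMap Φ (levelWeight a (n + 1)) x)

/-- Weights in `[0,1]` on simplices such that the simplices of positive weight are non-empty and form
a chain. -/
structure IsFlagWeight (a : Finset J → ℝ) : Prop where
  nonneg : ∀ s, 0 ≤ a s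
  le_one : ∀ s, a s ≤ 1
  nonempty : ∀ s, 0 < a s → s.Nonempty
  chain : ∀ s s', 0 < a s → 0 < a s' → s ⊆ s' ∨ s' ⊆ s

/-- The point `x` lies in the intersection of the covering that belongs to `s`, for every simplex `s`
of positive weight with at most `n` vertices. -/
def IsAdmissible (U : J → Set X) (a : Finset J → ℝ) (n : ℕ) (x : X) : Prop :=
  ∀ s, 0 < a s → s.card ≤ n → x ∈ ⋂ j ∈ s, U j

/-- Contractions, with the Lipschitz constants `L`, of all non-empty intersections of the sets
`U j` to points of theirs. -/
structure IsContractionSystem [MetricSpace X] (U : J → Set X) (L : Finset J → NNReal)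
    (Φ : Finset J → X → ℝ → X) (p : Finset J → X) : Prop where
  isLipContraction : ∀ s : Finset J, s.Nonempty → (⋂ j ∈ s, U j).Nonempty →
    IsLipContraction (L s) (⋂ j ∈ s, U j) (⋂ j ∈ s, U j) (Φ s) (p s)
  mem : ∀ s : Finset J, s.Nonempty → (⋂ j ∈ s, U j).Nonempty → p s ∈ ⋂ j ∈ s, U j

theorem IsGoodCovering.exists_isContractionSystem [MetricSpace X] [Nonempty X] {U : J → Set X}
    (hU : IsGoodCovering U) : ∃ L Φ p, IsContractionSystem U L Φ p := by
  have h : ∀ s : Finset J, ∃ (L : NNReal) (Φ : X → ℝ → X) (p : X), s.Nonempty →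
      (⋂ j ∈ s, U j).Nonempty →
      IsLipContraction L (⋂ j ∈ s, U j) (⋂ j ∈ s, U j) Φ p ∧ p ∈ ⋂ j ∈ s, U j := by
    intro s
    by_cases hs : s.Nonempty ∧ (⋂ j ∈ s, U j).Nonempty
    · obtain ⟨p, F, ⟨K, hK⟩, h0, h1, -⟩ := hU.exists_center s hs.1 hs.2
      obtain ⟨Φ, hΦ⟩ := exists_isLipContraction F hK (fun x => by rw [h0])
        (fun x => congrArg Subtype.val (mem_singleton_iff.1 (h1 x)))
      exact ⟨K, Φ, p, fun _ _ => ⟨hΦ, p.2⟩⟩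
    · exact ⟨0, fun x _ => x, Classical.arbitrary X, fun h1 h2 => (hs ⟨h1, h2⟩).elim⟩
  choose L Φ p hp using h
  exact ⟨L, Φ, p, ⟨fun s h1 h2 => (hp s h1 h2).1, fun s h1 h2 => (hp s h1 h2).2⟩⟩

variable {Φ : Finset J → X → ℝ → X} {a a' : Finset J → ℝ} {n m : ℕ} {x x' : X}
  {s s' : Finset J} {U : J → Set X}

theorem levelWeight_pos : 0 < levelWeight a n s ↔ s.card = n ∧ 0 < a s := by
  unfold levelWeight
  split_ifs with h <;> simp [h]

theorem levelWeight_card : levelWeight a s.card s = a s := if_pos rfl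

theorem IsFlagWeight.eq_of_levelWeight_pos (ha : IsFlagWeight a) (h : 0 < levelWeight a n s)
    (h' : 0 < levelWeight a n s') : s = s' := by
  obtain ⟨h1, h2⟩ := levelWeight_pos.1 h
  obtain ⟨h1', h2'⟩ := levelWeight_pos.1 h'
  rcases ha.chain s s' h2 h2' with h | h
  · exact Finset.eq_of_subset_of_card_le h (by omega)
  · exact (Finset.eq_of_subset_of_card_le h (by omega)).symm

theorem IsFlagWeight.subset_of_card_le (ha : IsFlagWeight a) (h : 0 < a s) (h' : 0 < a s')
    (hc : s'.card ≤ s.card) : s' ⊆ s := by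
  rcases ha.chain s s' h h' with h | h
  · exact (Finset.eq_of_subset_of_card_le h hc).symm.subset
  · exact h

theorem biInter_subset_of_finset_subset (h : s' ⊆ s) : ⋂ j ∈ s, U j ⊆ ⋂ j ∈ s', U j :=
  biInter_subset_biInter_left h

theorem descend_of_forall_le (h : ∀ s, a s ≤ 0) : descend Φ a n x = x := by
  induction n with
  | zero => rfl
  | succ n ih =>
    rw [descend, levelMap_of_forall_le, ih]
    exact fun s => not_lt.1 fun hs => (h s).not_gt (levelWeight_pos.1 hs).2

theorem descend_of_card_le (h : ∀ s, 0 < a s → s.card ≤ n) (hnm : n ≤ m) :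
    descend Φ a m x = descend Φ a n x := by
  induction m, hnm using Nat.le_induction with
  | base => rfl
  | succ m hm ih =>
    rw [descend, levelMap_of_forall_le, ih]
    intro s
    refine not_lt.1 fun hs => ?_
    obtain ⟨h1, h2⟩ := levelWeight_pos.1 hs
    have := h s h2
    omega

variable [MetricSpace X] {L : Finset J → NNReal} {p : Finset J → X}

/-- The simplices of lower levels are contained in the one that is used, so its contraction stays
inside their intersections. -/
theorem IsAdmissible.levelMap (hΦ : IsContractionSystem U L Φ p) (ha : IsFlagWeight a)
    (hx : IsAdmissible U a (n + 1) x) :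
    IsAdmissible U a n (levelMap Φ (levelWeight a (n + 1)) x) := by
  intro s' hs' hc'
  by_cases e : ∃ s, 0 < levelWeight a (n + 1) s
  · obtain ⟨s, hs⟩ := e
    obtain ⟨hc, hpos⟩ := levelWeight_pos.1 hs
    rw [levelMap_eq hs fun s' h => ha.eq_of_levelWeight_pos h hs]
    have hxs := hx s hpos hc.le
    refine biInter_subset_of_finset_subset (ha.subset_of_card_le hpos hs' (by omega))
      ((hΦ.isLipContraction s (ha.nonempty s hpos) ⟨x, hxs⟩).mem x hxs _ ⟨hs.le, ?_⟩)
    rw [← hc, levelWeight_card]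
    exact ha.le_one s
  · push Not at e
    rw [levelMap_of_forall_le e]
    exact hx s' hs' (by omega)

theorem dist_descend_le (hΦ : IsContractionSystem U L Φ p) {C : NNReal}
    (hC : ∀ s, 0 < a s ∨ 0 < a' s → L s ≤ C) (ha : IsFlagWeight a) (ha' : IsFlagWeight a')
    (hx : IsAdmissible U a n x) (hx' : IsAdmissible U a' n x') {ρ : ℝ} (hρ : dist x x' ≤ ρ)
    (haa : ∀ s, |a s - a' s| ≤ ρ) :
    dist (descend Φ a n x) (descend Φ a' n x') ≤ (2 * C + 1) ^ n * ρ := by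
  induction n generalizing x x' ρ with
  | zero => simpa [descend] using hρ
  | succ n ih =>
    have hρ0 : 0 ≤ ρ := dist_nonneg.trans hρ
    have hC0 : (0 : ℝ) ≤ C := C.2
    have hlw : ∀ {b : Finset J → ℝ}, IsFlagWeight b → (∀ s, 0 ≤ levelWeight b (n + 1) s) ∧
        ∀ s, levelWeight b (n + 1) s ≤ 1 := fun hb => by
      constructor <;> intro s <;> unfold levelWeight <;> split_ifs
      exacts [hb.nonneg s, le_rfl, hb.le_one s, zero_le_one]
    have hmem : ∀ {b : Finset J → ℝ} {y : X}, IsAdmissible U b (n + 1) y → ∀ s,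
        0 < levelWeight b (n + 1) s → y ∈ ⋂ j ∈ s, U j := fun hy s hs =>
      hy s (levelWeight_pos.1 hs).2 (levelWeight_pos.1 hs).1.le
    have h1 : dist (levelMap Φ (levelWeight a (n + 1)) x) (levelMap Φ (levelWeight a' (n + 1)) x') ≤
        (2 * C + 1) * ρ := by
      refine dist_levelMap_le (V := fun s => ⋂ j ∈ s, U j) (W := fun s => ⋂ j ∈ s, U j) (p := p) hC0
        (fun s hs => ?_) (hlw ha).1 (hlw ha).2 (hlw ha').1 (hlw ha').2
        (fun _ _ => ha.eq_of_levelWeight_pos) (fun _ _ => ha'.eq_of_levelWeight_pos)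
        (hmem hx) (hmem hx') hρ fun s => ?_
      · have hne : s.Nonempty ∧ (⋂ j ∈ s, U j).Nonempty := by
          rcases hs with hs | hs
          · exact ⟨ha.nonempty s (levelWeight_pos.1 hs).2, x, hmem hx s hs⟩
          · exact ⟨ha'.nonempty s (levelWeight_pos.1 hs).2, x', hmem hx' s hs⟩
        refine (hΦ.isLipContraction s hne.1 hne.2).mono ?_ subset_rfl subset_rfl
        exact NNReal.coe_le_coe.2 (hC s
          (hs.imp (fun h => (levelWeight_pos.1 h).2) fun h => (levelWeight_pos.1 h).2))
      · unfold levelWeight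
        split_ifs
        exacts [haa s, by simpa using hρ0]
    rw [descend, descend, pow_succ, mul_assoc]
    refine ih (hx.levelMap hΦ ha) (hx'.levelMap hΦ ha') h1 fun s => (haa s).trans ?_
    nlinarith [mul_nonneg hC0 hρ0]

/-- A simplex of weight `1` forgets the starting point. -/
theorem descend_eq_of_eq_one (hΦ : IsContractionSystem U L Φ p) (ha : IsFlagWeight a)
    (hs : a s = 1) (hn : s.card ≤ n) (hx : IsAdmissible U a n x) :
    descend Φ a n x = descend Φ a s.card (p s) := by
  have hpos : 0 < a s := hs ▸ one_pos
  induction n, hn using Nat.le_induction generalizing x with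
  | base =>
    have hne := ha.nonempty s hpos
    have hxs := hx s hpos le_rfl
    have hc := hΦ.isLipContraction s hne ⟨x, hxs⟩
    have key : ∀ y ∈ ⋂ j ∈ s, U j, levelMap Φ (levelWeight a s.card) y = p s := fun y hy => by
      have hl : 0 < levelWeight a s.card s := levelWeight_pos.2 ⟨rfl, hpos⟩
      rw [levelMap_eq hl fun s' h => ha.eq_of_levelWeight_pos h hl, levelWeight_card, hs,
        hc.one y hy]
    obtain ⟨k, hk⟩ := Nat.exists_eq_add_one.2 hne.card_pos
    rw [hk, descend, descend, ← hk, key x hxs, key _ (hΦ.mem s hne ⟨x, hxs⟩)]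
  | succ n hn ih =>
    rw [descend]
    exact ih (hx.levelMap hΦ ha)

end descend

/-! ### A space with a good covering is dominated by the nerve -/

section domination

variable {X : Type u} [MetricSpace X] {J : Type w} {U : J → Set X}

theorem isFlagWeight_simplexWeight (x : lp (fun _ : J => ℝ) ⊤) :
    IsFlagWeight fun s => simplexWeight s x where
  nonneg _ := simplexWeight_nonneg
  le_one _ := simplexWeight_le_one
  nonempty _ h := (of_simplexWeight_pos h).1
  chain _ _ := subset_or_subset_of_simplexWeight_pos

theorem IsFlagWeight.const_mul {a : Finset J → ℝ} (ha : IsFlagWeight a) {t : ℝ} (h0 : 0 ≤ t)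
    (h1 : t ≤ 1) : IsFlagWeight fun s => t * a s where
  nonneg s := mul_nonneg h0 (ha.nonneg s)
  le_one s := mul_le_one₀ h1 (ha.nonneg s) (ha.le_one s)
  nonempty s h := ha.nonempty s (pos_of_mul_pos_right h h0)
  chain s s' h h' := ha.chain s s' (pos_of_mul_pos_right h h0) (pos_of_mul_pos_right h' h0)

theorem exists_simplexWeight_eq_one_of_mem_nerve (hU : IsGoodCovering U)
    {x : lp (fun _ : J => ℝ) ⊤} (hx : x ∈ nerve U) : ∃ s, simplexWeight s x = 1 := by
  obtain ⟨j, hj⟩ := exists_apply_eq_one hU hx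
  exact exists_simplexWeight_eq_one hx.1 ((hU.finite_setOf_inter_nonempty j).subset
    fun i hi => inter_nonempty_of_mem_nerve hx hi (hj ▸ one_pos)) ⟨j, hj⟩

theorem abs_simplexWeight_sub_le_of_pos_imp_subset {x y : lp (fun _ : J => ℝ) ⊤} {A : Finset J}
    (hx : ∀ s, 0 < simplexWeight s x → s ⊆ A) (hy : ∀ s, 0 < simplexWeight s y → s ⊆ A)
    (s : Finset J) : |simplexWeight s x - simplexWeight s y| ≤ 2 ^ (A.card + 1) * dist x y := by
  by_cases hs : s ⊆ A
  · refine (abs_simplexWeight_sub_le s x y).trans (mul_le_mul_of_nonneg_right ?_ dist_nonneg)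
    exact pow_le_pow_right₀ one_le_two (by have := Finset.card_le_card hs; omega)
  · rw [le_antisymm (not_lt.1 fun h => hs (hx s h)) simplexWeight_nonneg,
      le_antisymm (not_lt.1 fun h => hs (hy s h)) simplexWeight_nonneg, sub_zero, abs_zero]
    positivity

/-- The map from the nerve to the space: on a flag of simplices, it starts at the centre of a simplex
of weight `1` and descends through the smaller simplices. -/
theorem exists_nerve_map (hU : IsGoodCovering U) {L : Finset J → NNReal}
    {Φ : Finset J → X → ℝ → X} {p : Finset J → X} (hΦ : IsContractionSystem U L Φ p) :
    ∃ ψ : nerve U → X, LocallyLipschitz ψ ∧ ∀ (x : nerve U) (n : ℕ) (z : X) (s : Finset J),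
      simplexWeight s x.1 = 1 → s.card ≤ n → IsAdmissible U (fun s => simplexWeight s x.1) n z →
      ψ x = descend Φ (fun s => simplexWeight s x.1) n z := by
  classical
  choose τ hτ using fun x : nerve U => exists_simplexWeight_eq_one_of_mem_nerve hU x.2
  have hne : ∀ (x : nerve U) s, 0 < simplexWeight s x.1 → (⋂ j ∈ s, U j).Nonempty := fun x s hs =>
    x.2.2.2 s fun i hi => ((of_simplexWeight_pos hs).2 i hi).1
  have hfl : ∀ x : nerve U, IsFlagWeight fun s => simplexWeight s x.1 := fun x =>
    isFlagWeight_simplexWeight x.1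
  -- The centre of a simplex is an admissible starting point.
  have hadm : ∀ (x : nerve U) s, 0 < simplexWeight s x.1 →
      IsAdmissible U (fun s => simplexWeight s x.1) s.card (p s) := fun x s hs s' hs' hc =>
    biInter_subset_of_finset_subset ((hfl x).subset_of_card_le hs hs' hc)
      (hΦ.mem s (of_simplexWeight_pos hs).1 (hne x s hs))
  let ψ : nerve U → X := fun x => descend Φ (fun s => simplexWeight s x.1) (τ x).card (p (τ x))
  have hψ : ∀ (x : nerve U) (n : ℕ) (z : X) (s : Finset J), simplexWeight s x.1 = 1 → s.card ≤ n →
      IsAdmissible U (fun s => simplexWeight s x.1) n z →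
      ψ x = descend Φ (fun s => simplexWeight s x.1) n z := by
    intro x n z s hs hn hz
    rw [descend_eq_of_eq_one hΦ (hfl x) hs hn hz]
    rcases le_total s.card (τ x).card with h | h
    · exact descend_eq_of_eq_one hΦ (hfl x) hs h (hadm x _ (by rw [hτ]; exact one_pos))
    · exact (descend_eq_of_eq_one hΦ (hfl x) (hτ x) h (hadm x _ (hs ▸ one_pos))).symm
  refine ⟨ψ, fun x₀ => ?_, hψ⟩
  obtain ⟨j, hj⟩ := exists_apply_eq_one hU x₀.2
  let A : Finset J := (hU.finite_setOf_inter_nonempty j).toFinset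
  let M : ℝ := 2 ^ (A.card + 1)
  have hM : 1 ≤ M := one_le_pow₀ one_le_two
  have hM0 : 0 < M := one_pos.trans_le hM
  have hA : ∀ x ∈ Metric.ball x₀ (1 / (2 * M)), ∀ s, 0 < simplexWeight s x.1 → s ⊆ A := by
    intro x hx s hs i hi
    have h1 := (abs_lt.1 ((abs_lp_apply_sub_le x.1 x₀.1 j).trans_lt hx)).1
    have h2 : 1 / (2 * M) < 1 := by rw [div_lt_one (by linarith)]; linarith
    rw [hj] at h1
    exact (hU.finite_setOf_inter_nonempty j).mem_toFinset.2
      (inter_nonempty_of_mem_nerve x.2 ((of_simplexWeight_pos hs).2 i hi).1 (by linarith))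
  have hx₀ : x₀ ∈ Metric.ball x₀ (1 / (2 * M)) := Metric.mem_ball_self (by positivity)
  -- The largest simplex `s₁` whose weight at `x₀` exceeds `1/2` has positive weight nearby, and
  -- contains the simplices that have weight `1` at some point nearby.
  obtain ⟨s₁, hs₁, hmax⟩ := (A.powerset.filter fun s => 1 / 2 < simplexWeight s x₀.1).exists_max_image
    Finset.card ⟨τ x₀, by
      rw [Finset.mem_filter, Finset.mem_powerset, hτ]
      exact ⟨hA x₀ hx₀ _ (by rw [hτ]; exact one_pos), by norm_num⟩⟩
  rw [Finset.mem_filter] at hs₁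
  have hclose : ∀ x ∈ Metric.ball x₀ (1 / (2 * M)), ∀ s,
      |simplexWeight s x.1 - simplexWeight s x₀.1| < 1 / 2 := by
    intro x hx s
    refine (abs_simplexWeight_sub_le_of_pos_imp_subset (hA x hx) (hA x₀ hx₀) s).trans_lt ?_
    have : dist x.1 x₀.1 < 1 / (2 * M) := hx
    calc M * dist x.1 x₀.1 < M * (1 / (2 * M)) := mul_lt_mul_of_pos_left this hM0
      _ = 1 / 2 := by field_simp
  have hpos : ∀ x ∈ Metric.ball x₀ (1 / (2 * M)), 0 < simplexWeight s₁ x.1 := fun x hx => by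
    linarith [(abs_lt.1 (hclose x hx s₁)).1, hs₁.2]
  have heq : ∀ x ∈ Metric.ball x₀ (1 / (2 * M)),
      ψ x = descend Φ (fun s => simplexWeight s x.1) s₁.card (p s₁) := by
    intro x hx
    refine hψ x _ _ (τ x) (hτ x) (hmax _ ?_) (hadm x s₁ (hpos x hx))
    rw [Finset.mem_filter, Finset.mem_powerset]
    refine ⟨hA x hx _ (by rw [hτ]; exact one_pos), ?_⟩
    have := (abs_lt.1 (hclose x hx (τ x))).2
    rw [hτ] at this
    linarith
  have hr : 0 < 1 / (2 * M) := by positivity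
  refine locallyLipschitzAt_of_dist_le (Metric.ball_mem_nhds x₀ hr)
    ((2 * (∑ s ∈ A.powerset, L s : NNReal) + 1) ^ s₁.card * M) fun x hx y hy => ?_
  rw [heq x hx, heq y hy, mul_assoc]
  refine dist_descend_le hΦ (fun s hs => ?_) (hfl x) (hfl y) (hadm x s₁ (hpos x hx))
    (hadm y s₁ (hpos y hy)) ?_
    (abs_simplexWeight_sub_le_of_pos_imp_subset (hA x hx) (hA y hy))
  · exact Finset.single_le_sum (f := L) (fun _ _ => zero_le)
      (Finset.mem_powerset.2 (hs.elim (hA x hx s) (hA y hy s)))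
  · rw [dist_self]
    positivity

theorem exists_lipschitz_bump {C O : Set X} (hC : IsCompact C) (hO : IsOpen O) (hCO : C ⊆ O) :
    ∃ (K : NNReal) (f : X → ℝ), LipschitzWith K f ∧ (∀ x, 0 ≤ f x) ∧ (∀ x, f x ≤ 1) ∧
      (∀ x ∈ C, f x = 1) ∧ ∀ x, 0 < f x → x ∈ O := by
  rcases C.eq_empty_or_nonempty with rfl | hne
  · exact ⟨0, fun _ => 0, LipschitzWith.const 0, fun _ => le_rfl, fun _ => zero_le_one, by simp,
      by simp⟩
  obtain ⟨δ, hδ, hδO⟩ := hC.exists_thickening_subset_open hO hCO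
  refine ⟨(δ⁻¹).toNNReal, fun x => max 0 (min 1 (1 - δ⁻¹ * Metric.infDist x C)), ?_,
    fun x => le_max_left _ _, fun x => max_le zero_le_one (min_le_left _ _), fun x hx => ?_,
    fun x hx => hδO ?_⟩
  · refine LipschitzWith.of_dist_le_mul fun x y => (abs_clamp_sub_clamp_le _ _).trans ?_
    rw [Real.coe_toNNReal _ (inv_nonneg.2 hδ.le), sub_sub_sub_cancel_left, ← mul_sub, abs_mul,
      abs_of_nonneg (inv_nonneg.2 hδ.le), abs_sub_comm]
    refine mul_le_mul_of_nonneg_left ?_ (inv_nonneg.2 hδ.le)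
    exact (Metric.lipschitz_infDist_pt C).dist_le_mul x y |>.trans (by simp)
  · simp [Metric.infDist_zero_of_mem hx]
  · rw [Metric.mem_thickening_iff_infDist_lt hne]
    by_contra! h
    have : 1 ≤ δ⁻¹ * Metric.infDist x C := by rwa [le_inv_mul_iff₀ hδ, mul_one]
    exact hx.ne' (max_eq_left ((min_le_right _ _).trans (by linarith)))

/-- A locally Lipschitz map to the nerve that is subordinate to the covering. -/
theorem exists_map_to_nerve (hU : IsGoodCovering U) :
    ∃ φ : X → nerve U, LocallyLipschitz φ ∧ ∀ x j, 0 < (φ x).1 j → x ∈ U j := by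
  classical
  obtain ⟨v, hv, -, hvU⟩ := exists_iUnion_eq_closure_subset hU.isOpen
    hU.locallyFinite.point_finite hU.iUnion_eq
  choose K f hK h0 h1 hC hO using fun j => exists_lipschitz_bump
    ((hU.isCompact_closure j).of_isClosed_subset isClosed_closure
      ((hvU j).trans subset_closure)) (hU.isOpen j) (hvU j)
  have hmem : ∀ x, Memℓp (fun j => f j x : J → ℝ) ⊤ := fun x => memℓp_infty ⟨1, by
    rintro _ ⟨j, rfl⟩
    simpa [abs_of_nonneg (h0 j x)] using h1 j x⟩
  have hnerve : ∀ x, (⟨_, hmem x⟩ : lp (fun _ : J => ℝ) ⊤) ∈ nerve U := by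
    refine fun x => ⟨fun j => h0 j x, le_antisymm ?_ ?_, fun s hs => ⟨x, ?_⟩⟩
    · exact lp.norm_le_of_forall_le zero_le_one fun j => by
        simpa [abs_of_nonneg (h0 j x)] using h1 j x
    · obtain ⟨j, hj⟩ := mem_iUnion.1 (hv.symm ▸ mem_univ x : x ∈ ⋃ j, v j)
      have := lp.norm_apply_le_norm ENNReal.top_ne_zero (⟨_, hmem x⟩ : lp (fun _ : J => ℝ) ⊤) j
      simpa [hC j x (subset_closure hj)] using this
    · exact mem_iInter₂.2 fun j hj => hO j x (hs j hj)
  refine ⟨fun x => ⟨⟨_, hmem x⟩, hnerve x⟩, fun x => ?_, fun x j => hO j x⟩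
  obtain ⟨O, hOx, hfin⟩ := hU.locallyFinite x
  refine locallyLipschitzAt_of_dist_le hOx (∑ j ∈ hfin.toFinset, K j : NNReal) fun y hy z hz => ?_
  rw [Subtype.dist_eq, dist_eq_norm]
  refine lp.norm_le_of_forall_le (by positivity) fun j => ?_
  change ‖f j y - f j z‖ ≤ _
  by_cases hj : j ∈ hfin.toFinset
  · rw [← dist_eq_norm]
    refine ((hK j).dist_le_mul y z).trans (mul_le_mul_of_nonneg_right ?_ dist_nonneg)
    exact NNReal.coe_le_coe.2 (Finset.single_le_sum (f := K) (fun _ _ => zero_le) hj)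
  · have hz0 : ∀ y ∈ O, f j y = 0 := fun y hy => le_antisymm (not_lt.1 fun h => hj
      (hfin.mem_toFinset.2 ⟨y, hO j y h, hy⟩)) (h0 j y)
    rw [hz0 y hy, hz0 z hz, sub_zero, norm_zero]
    positivity

/-- The space is a retract of the nerve up to homotopy, in the locally Lipschitz category: scaling
the times of the contractions down to `0` joins the composite of the two maps to the identity. -/
theorem IsGoodCovering.exists_domination (hU : IsGoodCovering U) :
    ∃ (φ : X → nerve U) (ψ : nerve U → X), LocallyLipschitz φ ∧ LocallyLipschitz ψ ∧
      LocLipHomotopic id (ψ ∘ φ) := by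
  classical
  rcases isEmpty_or_nonempty X with hX | hX
  · exact ⟨isEmptyElim, fun x => (x.2.2.2 ∅ (by simp)).some, isEmptyElim,
      fun x => isEmptyElim (x.2.2.2 ∅ (by simp)).some, fun z => z.1, fun z => isEmptyElim z.1,
      isEmptyElim, isEmptyElim⟩
  obtain ⟨L, Φ, p, hΦ⟩ := hU.exists_isContractionSystem
  obtain ⟨φ, hφ, hφU⟩ := exists_map_to_nerve hU
  obtain ⟨ψ, hψ, hψeq⟩ := exists_nerve_map hU hΦ
  let a : X × I → Finset J → ℝ := fun z s => z.2 * simplexWeight s (φ z.1).1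
  have ha : ∀ z, IsFlagWeight (a z) := fun z =>
    (isFlagWeight_simplexWeight (φ z.1).1).const_mul z.2.2.1 z.2.2.2
  have hpos : ∀ z s, 0 < a z s → 0 < simplexWeight s (φ z.1).1 := fun z s hs =>
    pos_of_mul_pos_right hs z.2.2.1
  have hmem : ∀ x s, 0 < simplexWeight s (φ x).1 → ∀ j ∈ s, x ∈ U j := fun x s hs j hj =>
    hφU x j ((of_simplexWeight_pos hs).2 j hj).1
  have hadm : ∀ x n, IsAdmissible U (fun s => simplexWeight s (φ x).1) n x := fun x n s hs _ =>
    mem_iInter₂.2 (hmem x s hs)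
  have hadm' : ∀ z n, IsAdmissible U (a z) n z.1 := fun z n s hs hc => hadm z.1 n s (hpos z s hs) hc
  let n : X → ℕ := fun x => (hU.locallyFinite.point_finite x).toFinset.card
  have hn : ∀ x s, 0 < simplexWeight s (φ x).1 → s.card ≤ n x := fun x s hs =>
    Finset.card_le_card fun j hj => (hU.locallyFinite.point_finite x).mem_toFinset.2
      (hmem x s hs j hj)
  refine ⟨φ, ψ, hφ, hψ, fun z => descend Φ (a z) (n z.1) z.1, fun z₀ => ?_, fun x => ?_, fun x => ?_⟩
  · obtain ⟨O, hO, hfin⟩ := hU.locallyFinite z₀.1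
    obtain ⟨K, O', hO', hK⟩ := hφ z₀.1
    let B := hfin.toFinset
    have hB : ∀ x ∈ O, ∀ s, 0 < simplexWeight s (φ x).1 → s ⊆ B := fun x hx s hs j hj =>
      hfin.mem_toFinset.2 ⟨x, hmem x s hs j hj, hx⟩
    have heq : ∀ z : X × I, z.1 ∈ O →
        descend Φ (a z) (n z.1) z.1 = descend Φ (a z) B.card z.1 := fun z hz =>
      (descend_of_card_le (fun s hs => hn z.1 s (hpos z s hs)) (Finset.card_le_card fun j hj =>
        hfin.mem_toFinset.2 ⟨z.1, (hU.locallyFinite.point_finite z.1).mem_toFinset.1 hj, hz⟩)).symm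
    refine locallyLipschitzAt_of_dist_le
      (continuous_fst.continuousAt.preimage_mem_nhds (Filter.inter_mem hO hO'))
      ((2 * (∑ s ∈ B.powerset, L s : NNReal) + 1) ^ B.card * (1 + 2 ^ (B.card + 1) * K))
      fun x hx y hy => ?_
    have d1 : dist x.1 y.1 ≤ dist x y := le_max_left _ _
    have d2 : |(x.2 : ℝ) - y.2| ≤ dist x y := le_max_right _ _
    rw [heq x hx.1, heq y hy.1, mul_assoc]
    refine dist_descend_le hΦ (fun s hs => ?_) (ha x) (ha y) (hadm' x _) (hadm' y _) ?_ fun s => ?_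
    · exact Finset.single_le_sum (f := L) (fun _ _ => zero_le) (Finset.mem_powerset.2
        (hs.elim (fun h => hB x.1 hx.1 s (hpos x s h)) fun h => hB y.1 hy.1 s (hpos y s h)))
    · rw [add_mul, one_mul]
      exact d1.trans (le_add_of_nonneg_right (by positivity))
    · refine (abs_mul_sub_mul_le (abs_le.2 ⟨by linarith [y.2.2.1], y.2.2.2⟩) (abs_le.2
        ⟨by linarith [simplexWeight_nonneg (s := s) (x := (φ x.1).1)],
          simplexWeight_le_one⟩)).trans ?_
      rw [add_mul, one_mul, mul_assoc]
      refine add_le_add d2 ((abs_simplexWeight_sub_le_of_pos_imp_subset (hB x.1 hx.1)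
        (hB y.1 hy.1) s).trans (mul_le_mul_of_nonneg_left ?_ (by positivity)))
      exact (hK.dist_le_mul x.1 hx.2 y.1 hy.2).trans (mul_le_mul_of_nonneg_left d1 K.2)
  · exact descend_of_forall_le fun s => by simp [a]
  · obtain ⟨s, hs⟩ := exists_simplexWeight_eq_one_of_mem_nerve hU (φ x).2
    have : a (x, 1) = fun s => simplexWeight s (φ x).1 := by
      funext s
      simp [a]
    change descend Φ (a (x, 1)) (n x) x = ψ (φ x)
    rw [this]
    exact (hψeq (φ x) (n x) x s hs (hn x s (hs ▸ one_pos)) (hadm x _)).symm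

end domination

/-! ### Comparison of the homotopy classes -/

section comparison

variable {X : Type u} {Y : Type v} [MetricSpace X] [MetricSpace Y]

theorem IsGoodCovering.subtype_nonempty {J : Type w} {U : J → Set X} (hU : IsGoodCovering U) :
    IsGoodCovering fun j : {j // (U j).Nonempty} => U j where
  isOpen j := hU.isOpen j
  iUnion_eq := eq_univ_of_forall fun x => by
    obtain ⟨j, hj⟩ := mem_iUnion.1 (hU.iUnion_eq.symm ▸ mem_univ x : x ∈ ⋃ j, U j)
    exact mem_iUnion.2 ⟨⟨j, x, hj⟩, hj⟩
  locallyFinite := hU.locallyFinite.comp_injective Subtype.val_injective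
  isCompact_closure j := hU.isCompact_closure j
  exists_center s hs hne := by
    have e : (⋂ j ∈ s, U j.1) = ⋂ j ∈ s.map (Function.Embedding.subtype _), U j := by
      ext x
      simp
    rw [e] at hne ⊢
    exact hU.exists_center _ (hs.map) hne

/-- A σ-compact space with a good covering has one that is indexed by a countable type. -/
theorem IsGoodCovering.exists_countable [SigmaCompactSpace X] {J : Type w} {U : J → Set X}
    (hU : IsGoodCovering U) :
    ∃ (J' : Type w) (U' : J' → Set X), Countable J' ∧ IsGoodCovering U' :=
  ⟨_, _, countable_univ_iff.1 (hU.subtype_nonempty.locallyFinite.countable_univ fun j => j.2),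
    hU.subtype_nonempty⟩

/-- A map of the interval onto itself that is constant near the ends. -/
noncomputable def stretch (t : I) : I := projIcc 0 1 zero_le_one (2 * (t : ℝ) - 1 / 2)

theorem continuous_stretch : Continuous stretch := by
  unfold stretch
  fun_prop

theorem stretch_of_le {t : I} (h : (t : ℝ) ≤ 1 / 4) : stretch t = 0 :=
  projIcc_of_le_left _ (by linarith)

theorem stretch_of_ge {t : I} (h : 3 / 4 ≤ (t : ℝ)) : stretch t = 1 :=
  projIcc_of_right_le _ (by linarith)

variable {J : Type w} {U : J → Set X}

/-- Every continuous map is homotopic to a locally Lipschitz one. Extend the composite of `f` with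
the map from the nerve constantly to the product of the nerve with the interval, and make it locally
Lipschitz at time `1/2` without a change at time `0`. -/
theorem IsGoodCovering.exists_locallyLipschitz_homotopic (hU : IsGoodCovering U) [Countable J]
    (hY : LocallyLipschitzContractible Y) (f : C(X, Y)) :
    ∃ g : C(X, Y), LocallyLipschitz g ∧ f.Homotopic g := by
  obtain ⟨φ, ψ, hφ, hψ, E, hE, E0, E1⟩ := hU.exists_domination
  obtain ⟨G, hG, hG0, -, -, hGl⟩ := exists_locallyLipschitzAt_nerve_prod hU hY
    (F := fun z : nerve U × I => f (ψ z.1)) (f.continuous.comp (hψ.continuous.comp continuous_fst))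
  let c : I := ⟨1 / 2, by norm_num, by norm_num⟩
  have hg : LocallyLipschitz fun x => G (φ x, c) := by
    have hφc : LocallyLipschitz fun x => (φ x, c) :=
      (LipschitzWith.prodMk_right c).locallyLipschitz.comp hφ
    exact fun x => (hGl (φ x, c) (by norm_num [c]) (by norm_num [c])).comp
      (g := fun x => (φ x, c)) hφc
  let h : C(X, Y) := ⟨fun x => f (ψ (φ x)),
    f.continuous.comp (hψ.continuous.comp hφ.continuous)⟩
  have h1 : f.Homotopic h := ⟨{
    toFun := fun z => f (E (z.2, z.1))
    continuous_toFun := f.continuous.comp (hE.continuous.comp continuous_swap)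
    map_zero_left := fun x => congrArg f (E0 x)
    map_one_left := fun x => congrArg f (E1 x) }⟩
  have hc : Continuous fun t : I => t * c := by fun_prop
  have h2 : h.Homotopic ⟨_, hg.continuous⟩ := ⟨{
    toFun := fun z => G (φ z.2, z.1 * c)
    continuous_toFun := hG.comp ((hφ.continuous.comp continuous_snd).prodMk
      (hc.comp continuous_fst))
    map_zero_left := fun x => by simp [hG0, h]
    map_one_left := fun x => by simp }⟩
  exact ⟨_, hg, h1.trans h2⟩

/-- Homotopic locally Lipschitz maps are locally Lipschitz homotopic: slow the homotopy down near its
ends, so that there it is locally Lipschitz already, and make it so in the middle. -/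
theorem IsGoodCovering.locLipHomotopic_of_homotopic (hU : IsGoodCovering U) [Countable J]
    (hY : LocallyLipschitzContractible Y) {f g : C(X, Y)} (hf : LocallyLipschitz f)
    (hg : LocallyLipschitz g) (h : f.Homotopic g) : LocLipHomotopic f g := by
  obtain ⟨φ, ψ, hφ, hψ, E, hE, E0, E1⟩ := hU.exists_domination
  obtain ⟨H⟩ := h
  have hend : ∀ {k : C(X, Y)}, LocallyLipschitz k → LocLipHomotopic k fun x => k (ψ (φ x)) :=
    fun {k} hk => ⟨fun z => k (E z), hk.comp hE, fun x => congrArg k (E0 x),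
      fun x => congrArg k (E1 x)⟩
  let F : nerve U × I → Y := fun z => H (stretch z.2, ψ z.1)
  have hF : Continuous F := H.continuous.comp ((continuous_stretch.comp continuous_snd).prodMk
    (hψ.continuous.comp continuous_fst))
  obtain ⟨G, hG, hG0, hG1, hGF, hGl⟩ := exists_locallyLipschitzAt_nerve_prod hU hY hF
  have hconst : ∀ {k : C(X, Y)}, LocallyLipschitz k →
      LocallyLipschitz fun z : nerve U × I => k (ψ z.1) := fun hk =>
    (hk.comp hψ).comp LipschitzWith.prod_fst.locallyLipschitz
  have hval : Continuous fun z : nerve U × I => (z.2 : ℝ) := by fun_prop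
  have hGlip : LocallyLipschitz G := by
    intro z
    rcases lt_or_ge (z.2 : ℝ) (1 / 4) with h | h
    · refine hGF z (LocallyLipschitzAt.congr (hconst hf z) ?_)
      filter_upwards [hval.continuousAt.eventually_lt_const h] with x hx
      simp [F, stretch_of_le hx.le]
    rcases lt_or_ge (3 / 4) (z.2 : ℝ) with h' | h'
    · refine hGF z (LocallyLipschitzAt.congr (hconst hg z) ?_)
      filter_upwards [hval.continuousAt.eventually_const_lt h'] with x hx
      simp [F, stretch_of_ge hx.le]
    · exact hGl z h h'
  refine locLipHomotopic_trans (hend hf) (locLipHomotopic_trans ?_ (locLipHomotopic_symm (hend hg)))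
  refine ⟨fun z => G (φ z.1, z.2), hGlip.comp ((hφ.comp
    LipschitzWith.prod_fst.locallyLipschitz).prodMk LipschitzWith.prod_snd.locallyLipschitz),
    fun x => ?_, fun x => ?_⟩
  · simp [hG0, F, stretch_of_le]
  · simp only [hG1, F]
    rw [stretch_of_ge (by norm_num), H.apply_one]

end comparison

theorem corollary1p5 {X : Type u} {Y : Type v} [MetricSpace X] [MetricSpace Y]
    [SigmaCompactSpace X] {J : Type w} (U : J → Set X) (hU : IsGoodCovering U)
    (hY : LocallyLipschitzContractible Y) :
    Function.Bijective (naturalMap X Y) ∧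
      ∀ f : C(X, Y), ∃ g : C(X, Y), LocallyLipschitz g ∧ f.Homotopic g := by
  obtain ⟨J', U', _, hU'⟩ := hU.exists_countable
  refine ⟨⟨?_, ?_⟩, hU'.exists_locallyLipschitz_homotopic hY⟩
  · intro a b
    induction a using Quotient.inductionOn with | h f => ?_
    induction b using Quotient.inductionOn with | h g => ?_
    intro h
    have h' : ContinuousMap.Homotopic (⟨f.1, f.2.continuous⟩ : C(X, Y)) ⟨g.1, g.2.continuous⟩ :=
      Quotient.exact (s := homotopySetoid X Y) h
    exact Quotient.sound (s := locLipHomotopySetoid X Y)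
      (hU'.locLipHomotopic_of_homotopic hY f.2 g.2 h')
  · intro b
    induction b using Quotient.inductionOn with | h f => ?_
    obtain ⟨g, hg, hfg⟩ := hU'.exists_locallyLipschitz_homotopic hY f
    exact ⟨Quotient.mk (locLipHomotopySetoid X Y) ⟨g, hg⟩,
      Quotient.sound (s := homotopySetoid X Y) hfg.symm⟩
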